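/- Let $n\ge 0$, let $\mathbb F=\mathbb Q(q,t)$, and let $\iota$ be the field automorphism of $\mathbb F$ with $\iota(q)=q^{-1}$, $\iota(t)=t^{-1}$. For $f\in\mathbb F[x]=\mathbb F[x_1,\dots,x_n]$ let $f^\circ$ be the polynomial obtained by applying $\iota$ to the coefficients of $f$. The symmetric group $S_n$ acts on $\mathbb F[x]$ and on $\mathbb F(x)$ by permuting the variables; $s_i$ interchanges $x_i$ and $x_{i+1}$, and $w_0\in S_n$ is the longest element $i\mapsto n+1-i$. The Demazure–Lusztig operators on $\mathbb F(x)$ are $$H_i=t\,s_i-\frac{(1-t)x_i}{x_i-x_{i+1}}(1-s_i),\qquad 1\le i<n,$$ and $H_w=H_{i_1}\cdots H_{i_\ell}$ for any reduced expression $w=s_{i_1}\cdots s_{i_\ell}$; $H_i^\circ$ and $H_w^\circ$ are these operators with $t$ replaced by $t^{-1}$. For $v\in\mathbb Z^n$ put $\overline v=(\overline v_1,\dots,\overline v_n)$ with $\overline v_i=q^{v_i}t^{-k_i(v)}$, where $k_i(v)=\#\{k<i\mid v_k\ge v_i\}+\#\{k>i\mid v_k>v_i\}$, and put $\widetilde v=\overline{(-v_n,\dots,-v_1)}$.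 For a composition $\alpha\in\mathbb Z_{\ge0}^n$ put $|\alpha|=\alpha_1+\cdots+\alpha_n$ and $\mathrm I(\alpha)=\#\{i<j\mid \alpha_i\ge\alpha_j\}$. **Theorem A.** Let $\alpha\in\mathbb Z_{\ge0}^n$. There is a unique polynomial $G_\alpha=G_\alpha(x;q,t)\in\mathbb F[x]$ of degree at most $|\alpha|$ in which $x^\alpha$ has coefficient $1$ and such that $G_\alpha(\overline\beta)=0$ for all $\beta\in\mathbb Z_{\ge0}^n$ with $|\beta|\le|\alpha|$ and $\beta\ne\alpha$. There is a unique polynomial $G'_\alpha=G'_\alpha(x;q,t)\in\mathbb F[x]$ of degree at most $|\alpha|$ that has the same homogeneous part of degree $|\alpha|$ as $G_\alpha$ and satisfies $G'_\alpha(\widetilde\beta)=0$ for all $\beta\in\mathbb Z_{\ge0}^n$ with $|\beta|<|\alpha|$. They are related by $$G'_\alpha(x)=t^{(1-n)|\alpha|+\mathrm I(\alpha)}\,w_0H^\circ_{w_0}\,G^\circ_\alpha(t^{n-1}x)$$ and, equivalently, with $G'_\alpha(x;q^{-1},t^{-1})=(G'_\alpha)^\circ(x)$, $$G'_\alpha(t^{n-1}x;q^{-1},t^{-1})=t^{(n-1)|\alpha|-\mathrm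 I(\alpha)}\,w_0H_{w_0}\,G_\alpha(x;q,t).$$ -/

import Mathlib

noncomputable section

namespace InterpolationMacdonald

/-- The ground field `𝔽 = ℚ(q, t)` of rational functions in two indeterminates. -/
abbrev BaseField : Type := FractionRing (MvPolynomial (Fin 2) ℚ)

/-- The indeterminate `q` of `𝔽`. -/
def q : BaseField := algebraMap (MvPolynomial (Fin 2) ℚ) BaseField (MvPolynomial.X 0)

/-- The indeterminate `t` of `𝔽`. -/
def t : BaseField := algebraMap (MvPolynomial (Fin 2) ℚ) BaseField (MvPolynomial.X 1)

/-- Substitution of `q⁻¹` for `q` and `t⁻¹` for `t` in a polynomial in `q` and `t`. -/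
def invertHom : MvPolynomial (Fin 2) ℚ →ₐ[ℚ] BaseField := MvPolynomial.aeval ![q⁻¹, t⁻¹]

theorem q_ne_zero : q ≠ 0 := by
  simp [q]

theorem t_ne_zero : t ≠ 0 := by
  simp [t]

theorem invertHom_injective : Function.Injective invertHom := by
  rw [injective_iff_map_eq_zero]
  intro p hp
  set D : Fin 2 →₀ ℕ := p.support.sup id with hD
  have hle : ∀ m ∈ p.support, m ≤ D := fun m hm => Finset.le_sup (f := id) hm
  have key : algebraMap (MvPolynomial (Fin 2) ℚ) BaseField
      (∑ m ∈ p.support, MvPolynomial.monomial (D - m) (p.coeff m))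
      = invertHom p * (q ^ D 0 * t ^ D 1) := by
    conv_rhs => rw [p.as_sum]
    rw [map_sum, map_sum, Finset.sum_mul]
    refine Finset.sum_congr rfl fun m hm => ?_
    have h0 : D 0 = (D - m) 0 + m 0 := by
      have := hle m hm 0
      simp only [Finsupp.tsub_apply]; omega
    have h1 : D 1 = (D - m) 1 + m 1 := by
      have := hle m hm 1
      simp only [Finsupp.tsub_apply]; omega
    have hq := q_ne_zero
    have ht := t_ne_zero
    rw [h0, h1, invertHom, MvPolynomial.aeval_monomial, MvPolynomial.monomial_eq,
      Finsupp.prod_fintype _ _ (by simp), Finsupp.prod_fintype _ _ (by simp)]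
    have hc : algebraMap (MvPolynomial (Fin 2) ℚ) BaseField (MvPolynomial.C (p.coeff m))
        = algebraMap ℚ BaseField (p.coeff m) := by
      rw [IsScalarTower.algebraMap_apply ℚ (MvPolynomial (Fin 2) ℚ) BaseField]
      rfl
    simp only [Fin.prod_univ_two, map_mul, map_pow, hc, Matrix.cons_val_zero, Matrix.cons_val_one]
    change _ * (q ^ _ * t ^ _) = _
    have e0 : q ^ m 0 * q⁻¹ ^ m 0 = 1 := by rw [← mul_pow, mul_inv_cancel₀ hq, one_pow]
    have e1 : t ^ m 1 * t⁻¹ ^ m 1 = 1 := by rw [← mul_pow, mul_inv_cancel₀ ht, one_pow]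
    rw [pow_add, pow_add]
    set c := algebraMap ℚ BaseField (p.coeff m)
    calc c * (q ^ (D - m) 0 * t ^ (D - m) 1)
        = c * (q ^ (D - m) 0 * t ^ (D - m) 1) * (q ^ m 0 * q⁻¹ ^ m 0) * (t ^ m 1 * t⁻¹ ^ m 1) := by
          rw [e0, e1, mul_one, mul_one]
      _ = _ := by ring
  rw [hp, zero_mul, FaithfulSMul.algebraMap_eq_zero_iff] at key
  ext m
  by_cases hm : m ∈ p.support
  · have h := congrArg (MvPolynomial.coeff (D - m)) key
    rw [MvPolynomial.coeff_sum, Finset.sum_eq_single m] at h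
    · simpa using h
    · intro m' hm' hne
      rw [MvPolynomial.coeff_monomial, if_neg]
      intro he
      apply hne
      rw [← tsub_tsub_cancel_of_le (hle m' hm'), he, tsub_tsub_cancel_of_le (hle m hm)]
    · intro h'; exact absurd hm h'
  · simpa using hm

/-- The field endomorphism (in fact involution) `ι` of `𝔽` with `ι(q) = q⁻¹`, `ι(t) = t⁻¹`. -/
def iota : BaseField →+* BaseField :=
  IsFractionRing.lift (g := invertHom.toRingHom) invertHom_injective

theorem iota_q : iota q = q⁻¹ := by
  simp [iota, q, invertHom]

theorem iota_t : iota t = t⁻¹ := by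
  simp [iota, t, invertHom]

/-- `𝔽[x] = 𝔽[x₁, …, xₙ]`; the variable `x_i` has the index `i - 1` in `Fin n`. -/
abbrev PolyRing (n : ℕ) : Type := MvPolynomial (Fin n) BaseField

/-- `𝔽(x)`, the quotient field of `𝔽[x]`. -/
abbrev RatFun (n : ℕ) : Type := FractionRing (PolyRing n)

/-- The action of `ι` on the coefficients of a polynomial, `f ↦ f°`. -/
def circ {n : ℕ} (f : PolyRing n) : PolyRing n := MvPolynomial.map iota f

/-- The polynomial `f(c x) = f(c x₁, …, c xₙ)`. -/
def scale {n : ℕ} (c : BaseField) (f : PolyRing n) : PolyRing n :=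
  MvPolynomial.bind₁ (fun i => MvPolynomial.C c * MvPolynomial.X i) f

/-- `|α| = α₁ + ⋯ + αₙ`. -/
def size {n : ℕ} (α : Fin n → ℕ) : ℕ := ∑ i, α i

/-- `I(α) = #{i < j | α_i ≥ α_j}`. -/
def invCount {n : ℕ} (α : Fin n → ℕ) : ℕ :=
  (Finset.univ.filter fun p : Fin n × Fin n => p.1 < p.2 ∧ α p.2 ≤ α p.1).card

/-- `k_i(v) = #{k < i | v_k ≥ v_i} + #{k > i | v_k > v_i}`. -/
def kStat {n : ℕ} (v : Fin n → ℤ) (i : Fin n) : ℕ :=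
  (Finset.univ.filter fun k : Fin n => k < i ∧ v i ≤ v k).card +
    (Finset.univ.filter fun k : Fin n => i < k ∧ v i < v k).card

/-- The spectral vector `v̄ ∈ 𝔽ⁿ` of `v ∈ ℤⁿ`, with `v̄_i = q ^ v_i * t ^ (-k_i(v))`. -/
def bar {n : ℕ} (v : Fin n → ℤ) (i : Fin n) : BaseField :=
  q ^ v i * t ^ (-(kStat v i : ℤ))

/-- The point `ṽ`, which is the spectral vector of `-w₀ v = (-vₙ, …, -v₁)`. -/
def tilde {n : ℕ} (v : Fin n → ℤ) : Fin n → BaseField :=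
  bar fun i => -v i.rev

/-- `G` is the non-symmetric interpolation Macdonald polynomial `G_α = G_α(x; q, t)`: its degree
is at most `|α|`, it vanishes at `β̄` for all compositions `β ≠ α` with `|β| ≤ |α|`, and the
coefficient of `x^α` in it is `1`. -/
structure IsInterpolation {n : ℕ} (α : Fin n → ℕ) (G : PolyRing n) : Prop where
  degree_le : G.totalDegree ≤ size α
  vanishing : ∀ β : Fin n → ℕ, size β ≤ size α → β ≠ α →
    MvPolynomial.eval (bar fun i => (β i : ℤ)) G = 0
  coeff_eq_one : MvPolynomial.coeff (Finsupp.equivFunOnFinite.symm α) G = 1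

/-- `P` is the primed interpolation polynomial `G'_α = G'_α(x; q, t)`, where `G` is the polynomial
`G_α`: its degree is at most `|α|`, its homogeneous part of degree `|α|` is that of `G_α`, and it
vanishes at `β̃` for all compositions `β` with `|β| < |α|`. -/
structure IsPrimedInterpolation {n : ℕ} (α : Fin n → ℕ) (G P : PolyRing n) : Prop where
  degree_le : P.totalDegree ≤ size α
  top_eq : MvPolynomial.homogeneousComponent (size α) P =
    MvPolynomial.homogeneousComponent (size α) G
  vanishing : ∀ β : Fin n → ℕ, size β < size α →
    MvPolynomial.eval (tilde fun i => (β i : ℤ)) P = 0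

/-- The action of `w ∈ Sₙ` on `𝔽(x)`: the field automorphism over `𝔽` with `x_i ↦ x_{w(i)}`. -/
def permute {n : ℕ} (w : Equiv.Perm (Fin n)) : RatFun n →ₐ[BaseField] RatFun n :=
  IsFractionRing.liftAlgHom (R := BaseField)
    (g := (IsScalarTower.toAlgHom BaseField (PolyRing n) (RatFun n)).comp
      (MvPolynomial.renameEquiv BaseField w : PolyRing n →ₐ[BaseField] PolyRing n))
    ((IsFractionRing.injective (PolyRing n) (RatFun n)).comp
      (MvPolynomial.renameEquiv BaseField w).injective)

/-- The element `x_i` of `𝔽(x)`. -/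
def x {n : ℕ} (i : Fin n) : RatFun n := algebraMap (PolyRing n) (RatFun n) (MvPolynomial.X i)

/-- The position `i` (with `0 ≤ i < n - 1`) in `Fin n`. -/
def lo {n : ℕ} (i : Fin (n - 1)) : Fin n := ⟨i, by omega⟩

/-- The position `i + 1` (with `0 ≤ i < n - 1`) in `Fin n`. -/
def hi {n : ℕ} (i : Fin (n - 1)) : Fin n := ⟨i + 1, by omega⟩

/-- The simple transposition `s_i` that swaps the neighbours `i` and `i + 1`. -/
def simple {n : ℕ} (i : Fin (n - 1)) : Equiv.Perm (Fin n) := Equiv.swap (lo i) (hi i)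

/-- The Demazure–Lusztig operator with parameter `s` on `𝔽(x)`,
`f ↦ s • s_i f - ((1 - s) x_i / (x_i - x_{i+1})) (f - s_i f)`.
It is `H_i` for `s = t` and `H_i°` for `s = t⁻¹`. -/
def demazureLusztig {n : ℕ} (s : BaseField) (i : Fin (n - 1)) :
    Module.End BaseField (RatFun n) :=
  s • (permute (simple i)).toLinearMap -
    LinearMap.mulLeft BaseField
      ((algebraMap BaseField (RatFun n) (1 - s) * x (lo i)) / (x (lo i) - x (hi i))) *
      (1 - (permute (simple i)).toLinearMap)

/-- The word `l = [i₁, …, i_ℓ]` is a reduced expression of `w`, that is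
`w = s_{i₁} ⋯ s_{i_ℓ}` and no shorter word in the simple transpositions has this product. -/
def IsReducedWord {n : ℕ} (l : List (Fin (n - 1))) (w : Equiv.Perm (Fin n)) : Prop :=
  (l.map simple).prod = w ∧
    ∀ l' : List (Fin (n - 1)), (l'.map simple).prod = w → l.length ≤ l'.length

theorem exists_isReducedWord {n : ℕ} (w : Equiv.Perm (Fin n)) :
    ∃ l : List (Fin (n - 1)), IsReducedWord l w := by
  have hw : ∃ l : List (Fin (n - 1)), (l.map simple).prod = w := by
    rcases n with _ | n
    · exact ⟨[], Subsingleton.elim _ _⟩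
    · have h : w ∈ Submonoid.closure
          (Set.range fun i : Fin n => Equiv.swap i.castSucc i.succ) := by
        rw [Equiv.Perm.mclosure_swap_castSucc_succ]; trivial
      induction h using Submonoid.closure_induction with
      | mem y hy =>
        obtain ⟨i, rfl⟩ := hy
        exact ⟨[i], by simp [simple]; rfl⟩
      | one => exact ⟨[], rfl⟩
      | mul y z _ _ hy hz =>
        obtain ⟨l, hl⟩ := hy
        obtain ⟨l', hl'⟩ := hz
        exact ⟨l ++ l', by rw [List.map_append, List.prod_append, hl, hl']⟩
  have hk : ∃ k : ℕ, ∃ l : List (Fin (n - 1)), (l.map simple).prod = w ∧ l.length = k :=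
    hw.elim fun l hl => ⟨_, l, hl, rfl⟩
  classical
  obtain ⟨l, hl, hlen⟩ := Nat.find_spec hk
  exact ⟨l, hl, fun l' hl' => hlen ▸ Nat.find_min' hk ⟨l', hl', rfl⟩⟩

/-- The operator product `H_{i₁} ⋯ H_{i_ℓ}` with parameter `s`, for the word `l = [i₁, …, i_ℓ]`.
When `l` is a reduced expression of `w`, it is `H_w` for `s = t` and `H_w°` for `s = t⁻¹`. -/
def heckeWord {n : ℕ} (s : BaseField) (l : List (Fin (n - 1))) :
    Module.End BaseField (RatFun n) :=
  (l.map (demazureLusztig s)).prod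

/-- The longest element `w₀` of `Sₙ`, `i ↦ n + 1 - i` for `1 ≤ i ≤ n`. -/
def longest (n : ℕ) : Equiv.Perm (Fin n) := Fin.revPerm

end InterpolationMacdonald

end

open InterpolationMacdonald

noncomputable section

namespace InterpolationMacdonald

/-! ### Simple transpositions and the statistic `invCount` -/

section Combinatorics

variable {n : ℕ}

/-! Let `E` be the homogeneous part of degree |α| of G_α. Since β̃ = t^(1-n) ι(w₀ β̄) (`tilde_eq`),
the map f ↦ w₀ f°(t^(n-1) x) exchanges vanishing at the points β̃ with vanishing at the points β̄
(`eval_tilde`). So the formula for G'_α needs two facts about H_{w₀} G_α: it vanishes at β̄ for |β|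
< |α|, and its top part is t^I(α) w₀ E°.

The first fact holds because each H_i preserves the polynomials vanishing at all β̄ with |β| < d
(`eval_demLusWord_eq_zero`): if β_i ≠ β_{i+1}, then s_i permutes the spectral vectors; if β_i =
β_{i+1}, the coefficient x_i - t x_{i+1} of s_i f vanishes at β̄. Uniqueness of both polynomials
rests on `eq_zero_of_vanishing`: a polynomial of degree < d that vanishes at all β̄ with |β| < d is
zero.

The second fact, H_{w₀} E = t^I(α) w₀ E°, is proved together with the existence of G_α by a
recursion on α with two moves (`exists_isTriangular`).

For α_i < α_{i+1}, the polynomial (H_i + c) G_α has index s_i α (`IsTriangular.comp_simple`). The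
identity survives because H_{w₀} H_i = H_{n-i} H_{w₀}, while conjugation by w₀ turns H_i° into the
inverse of H_{n-i}.

The affine move (a, β) ↦ (β, a+1) is realised by the raising operator `raiseOp`
(`IsTriangular.raise`). With N variables, G_α + H_1⋯H_{N-1} `raiseOp` G_α = x_1 G_α / ᾱ_1
(`demLusWord_raise`); its top part, with H_i x_{i+1} H_i = t x_i, makes E an eigenvector of
`unshift` ∘ H_{N-1}⋯H_1. Two factorisations of w₀ through a parabolic S_{N-1}, one fixing the last
and one the first position, then carry the identity from E to the raised polynomial. These arguments
use the braid relations and the independence of H_{w₀} from the reduced word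
(`prod_map_eq_of_braid`).

The order `Below` serves normalisation: E is triangular for it, so the leading coefficient stays 1
under the first move. -/

@[simp] theorem simple_lo (i : Fin (n - 1)) : simple i (lo i) = hi i :=
  Equiv.swap_apply_left _ _

@[simp] theorem simple_hi (i : Fin (n - 1)) : simple i (hi i) = lo i :=
  Equiv.swap_apply_right _ _

theorem simple_of_ne {i : Fin (n - 1)} {k : Fin n} (h1 : k ≠ lo i) (h2 : k ≠ hi i) :
    simple i k = k :=
  Equiv.swap_apply_of_ne_of_ne h1 h2

@[simp] theorem simple_simple (i : Fin (n - 1)) (k : Fin n) : simple i (simple i k) = k :=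
  Equiv.swap_apply_self _ _ _

@[simp] theorem simple_mul_self (i : Fin (n - 1)) : simple i * simple i = 1 :=
  Equiv.swap_mul_self _ _

theorem comp_simple_comp_simple {A : Type*} (α : Fin n → A) (i : Fin (n - 1)) :
    (α ∘ simple i) ∘ simple i = α := by
  funext k; simp

theorem comp_simple_eq_self {A : Type*} {α : Fin n → A} {i : Fin (n - 1)}
    (h : α (lo i) = α (hi i)) : α ∘ simple i = α := by
  funext k
  by_cases h1 : k = lo i
  · subst h1; rw [Function.comp_apply, simple_lo, h]
  by_cases h2 : k = hi i
  · subst h2; rw [Function.comp_apply, simple_hi, h]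
  · rw [Function.comp_apply, simple_of_ne h1 h2]

theorem lo_lt_hi (i : Fin (n - 1)) : lo i < hi i := by
  simp [lo, hi, Fin.lt_def]

theorem lo_ne_hi (i : Fin (n - 1)) : lo i ≠ hi i := (lo_lt_hi i).ne

theorem simple_lt_simple {i : Fin (n - 1)} {p k : Fin n} (h : p < k)
    (hne : ¬ (p = lo i ∧ k = hi i)) : simple i p < simple i k := by
  have hi' := i.2
  simp only [simple, Equiv.swap_apply_def, lo, hi, Fin.ext_iff, Fin.lt_def] at *
  split_ifs <;> (try dsimp only) <;> omega

theorem size_comp (α : Fin n → ℕ) (w : Equiv.Perm (Fin n)) : size (α ∘ w) = size α :=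
  Equiv.sum_comp w α

/-- Applying s_i to both positions of a pair keeps their order except for the pair (i, i+1) itself,
which is the one extra pair counted. -/
theorem invCount_comp_simple {α : Fin n → ℕ} {i : Fin (n - 1)} (h : α (lo i) < α (hi i)) :
    invCount (α ∘ simple i) = invCount α + 1 := by
  unfold invCount
  have hmem : (lo i, hi i) ∈ Finset.univ.filter fun p : Fin n × Fin n =>
      p.1 < p.2 ∧ (α ∘ simple i) p.2 ≤ (α ∘ simple i) p.1 := by
    simp [lo_lt_hi, h.le]
  rw [← Finset.card_erase_add_one hmem]
  congr 1
  refine Finset.card_bij' (fun p _ => (simple i p.1, simple i p.2))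
    (fun p _ => (simple i p.1, simple i p.2)) ?_ ?_ ?_ ?_
  · rintro ⟨p, k⟩ hp
    simp only [Finset.mem_erase, Finset.mem_filter, Finset.mem_univ, true_and, ne_eq,
      Prod.mk.injEq, Function.comp_apply] at hp ⊢
    exact ⟨simple_lt_simple hp.2.1 hp.1, hp.2.2⟩
  · rintro ⟨p, k⟩ hp
    simp only [Finset.mem_erase, Finset.mem_filter, Finset.mem_univ, true_and, ne_eq,
      Prod.mk.injEq, Function.comp_apply, simple_simple] at hp ⊢
    have hne : ¬ (p = lo i ∧ k = hi i) := by
      rintro ⟨rfl, rfl⟩; exact absurd hp.2 (not_le.2 h)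
    refine ⟨?_, simple_lt_simple hp.1 hne, hp.2⟩
    rintro ⟨h1, h2⟩
    have h1' : p = hi i := by rw [← simple_lo, ← h1, simple_simple]
    have h2' : k = lo i := by rw [← simple_hi, ← h2, simple_simple]
    rw [h1', h2'] at hp
    exact absurd hp.1 (lo_lt_hi i).not_gt
  · rintro ⟨p, k⟩ _; simp
  · rintro ⟨p, k⟩ _; simp

theorem invCount_comp_simple' {α : Fin n → ℕ} {i : Fin (n - 1)} (h : α (hi i) < α (lo i)) :
    invCount (α ∘ simple i) + 1 = invCount α := by
  have := invCount_comp_simple (α := α ∘ simple i) (i := i) (by simpa using h)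
  rw [comp_simple_comp_simple] at this
  exact this.symm

theorem monotone_of_lo_le_hi {A : Type*} [Preorder A] {α : Fin n → A}
    (h : ∀ i, α (lo i) ≤ α (hi i)) : Monotone α := by
  rcases n with _ | n
  · intro i; exact i.elim0
  · exact Fin.monotone_iff_le_succ.2 fun i => h i

theorem invCount_cons (a : ℕ) (α : Fin n → ℕ) :
    invCount (Fin.cons a α : Fin (n + 1) → ℕ) =
      (Finset.univ.filter fun j => α j ≤ a).card + invCount α := by
  simp only [invCount, Finset.card_filter, Fintype.sum_prod_type, Fin.sum_univ_succ,
    Fin.cons_zero, Fin.cons_succ]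
  simp

theorem invCount_snoc (a : ℕ) (α : Fin n → ℕ) :
    invCount (Fin.snoc α a : Fin (n + 1) → ℕ) =
      (Finset.univ.filter fun j => a ≤ α j).card + invCount α := by
  simp only [invCount, Finset.card_filter, Fintype.sum_prod_type, Fin.sum_univ_castSucc,
    Fin.snoc_castSucc, Fin.snoc_last, Finset.sum_add_distrib]
  simp [Fin.castSucc_lt_last, add_comm, (Fin.castSucc_lt_last _).not_gt]

/-- The number of inversions of a permutation. -/
def inversions (w : Equiv.Perm (Fin n)) : ℕ := invCount fun i => (w i : ℕ)

theorem inversions_mul_simple {w : Equiv.Perm (Fin n)} {i : Fin (n - 1)} (h : w (lo i) < w (hi i)) :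
    inversions (w * simple i) = inversions w + 1 :=
  invCount_comp_simple (α := fun i => (w i : ℕ)) h

theorem inversions_mul_simple' {w : Equiv.Perm (Fin n)} {i : Fin (n - 1)}
    (h : w (hi i) < w (lo i)) : inversions (w * simple i) + 1 = inversions w :=
  invCount_comp_simple' (α := fun i => (w i : ℕ)) h

theorem inversions_one : inversions (1 : Equiv.Perm (Fin n)) = 0 := by
  simp only [inversions, invCount, Finset.card_eq_zero, Finset.filter_eq_empty_iff]
  rintro ⟨p, k⟩ _ ⟨h1, h2⟩
  exact absurd h1 (not_lt.2 h2)

theorem eq_one_of_monotone {w : Equiv.Perm (Fin n)} (h : Monotone w) : w = 1 := by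
  have hs : StrictMono w := h.strictMono_of_injective w.injective
  have : (hs.orderIsoOfSurjective w w.surjective) = OrderIso.refl _ := Subsingleton.elim _ _
  ext i
  have := congrArg (fun e : Fin n ≃o Fin n => e i) this
  simpa using congrArg Fin.val this

theorem exists_descent {w : Equiv.Perm (Fin n)} (h : w ≠ 1) : ∃ i, w (hi i) < w (lo i) := by
  by_contra! hc
  exact h (eq_one_of_monotone (monotone_of_lo_le_hi hc))

/-- The permutation given by a word in the simple transpositions. -/
def wordPerm (l : List (Fin (n - 1))) : Equiv.Perm (Fin n) := (l.map simple).prod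

@[simp] theorem wordPerm_nil : wordPerm ([] : List (Fin (n - 1))) = 1 := rfl

@[simp] theorem wordPerm_append (l l' : List (Fin (n - 1))) :
    wordPerm (l ++ l') = wordPerm l * wordPerm l' := by
  simp [wordPerm]

@[simp] theorem wordPerm_singleton (i : Fin (n - 1)) : wordPerm [i] = simple i := by
  simp [wordPerm]

@[simp] theorem wordPerm_cons (i : Fin (n - 1)) (l : List (Fin (n - 1))) :
    wordPerm (i :: l) = simple i * wordPerm l := by
  simp [wordPerm]

theorem ne_of_descent (w : Equiv.Perm (Fin n)) (i : Fin (n - 1)) : w (lo i) ≠ w (hi i) :=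
  fun h => lo_ne_hi i (w.injective h)

theorem inversions_wordPerm_le (l : List (Fin (n - 1))) : inversions (wordPerm l) ≤ l.length := by
  induction l using List.reverseRecOn with
  | nil => simp [inversions_one]
  | append_singleton l i ih =>
    rw [wordPerm_append, wordPerm_singleton, List.length_append, List.length_singleton]
    rcases lt_or_gt_of_ne (ne_of_descent (wordPerm l) i) with h | h
    · rw [inversions_mul_simple h]; omega
    · have := inversions_mul_simple' h; omega

theorem exists_word_length_eq_inversions (w : Equiv.Perm (Fin n)) :
    ∃ l, wordPerm l = w ∧ l.length = inversions w := by
  induction h : inversions w using Nat.strong_induction_on generalizing w with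
  | _ k ih =>
    by_cases hw : w = 1
    · exact ⟨[], hw.symm, by rw [← h, hw, inversions_one]; rfl⟩
    · obtain ⟨i, hi⟩ := exists_descent hw
      have h1 := inversions_mul_simple' hi
      obtain ⟨l, hl, hlen⟩ := ih _ (by omega) (w * simple i) rfl
      refine ⟨l ++ [i], ?_, ?_⟩
      · rw [wordPerm_append, hl, wordPerm_singleton, mul_assoc, simple_mul_self, mul_one]
      · rw [List.length_append, List.length_singleton]; omega

/-- A letter changes the inversion number by exactly one, and every w ≠ 1 has a descent that lowers
it. Reducedness thus becomes a count. -/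
theorem isReducedWord_iff {l : List (Fin (n - 1))} {w : Equiv.Perm (Fin n)} :
    IsReducedWord l w ↔ wordPerm l = w ∧ l.length = inversions w := by
  constructor
  · rintro ⟨h1, h2⟩
    refine ⟨h1, le_antisymm ?_ ?_⟩
    · obtain ⟨l', hl', hlen⟩ := exists_word_length_eq_inversions w
      exact hlen ▸ h2 l' hl'
    · have := inversions_wordPerm_le l
      rwa [show wordPerm l = w from h1] at this
  · rintro ⟨h1, h2⟩
    refine ⟨h1, fun l' hl' => ?_⟩
    have := inversions_wordPerm_le l'
    rw [show wordPerm l' = w from hl'] at this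
    omega

theorem simple_mul_simple_comm {i j : Fin (n - 1)} (h : (i : ℕ) + 1 < j) :
    simple i * simple j = simple j * simple i := by
  refine (Equiv.Perm.Disjoint.commute fun k => ?_).eq
  by_cases hk : k = lo i ∨ k = hi i
  · right
    refine simple_of_ne ?_ ?_ <;> rcases hk with rfl | rfl <;>
      simp only [lo, hi, ne_eq, Fin.ext_iff] <;> omega
  · left
    rw [not_or] at hk
    exact simple_of_ne hk.1 hk.2

theorem simple_braid {i j : Fin (n - 1)} (h : (i : ℕ) + 1 = j) :
    simple i * simple j * simple i = simple j * simple i * simple j := by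
  have hi' := i.2
  have hj' := j.2
  have e : lo j = hi i := by simp [lo, hi, h]
  have h1 : lo i ≠ hi j := by simp only [lo, hi, ne_eq, Fin.ext_iff]; omega
  have h2 := lo_ne_hi i
  have h3 := lo_ne_hi j
  rw [simple, simple, e]
  rw [e] at h3
  rw [Equiv.swap_mul_swap_mul_swap h2 h1, Equiv.swap_comm (lo i), Equiv.swap_comm (hi i) (hi j),
    Equiv.swap_mul_swap_mul_swap h3.symm h1.symm, Equiv.swap_comm]

/-- Words of the same reduced length for the same permutation have the same value in every monoid
with elements that satisfy the braid relations. -/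
theorem prod_map_eq_of_braid {M : Type*} [Monoid M] (T : Fin (n - 1) → M)
    (hcomm : ∀ i j : Fin (n - 1), (i : ℕ) + 1 < j → T i * T j = T j * T i)
    (hbraid : ∀ i j : Fin (n - 1), (i : ℕ) + 1 = j → T i * T j * T i = T j * T i * T j)
    {w : Equiv.Perm (Fin n)} {l l' : List (Fin (n - 1))}
    (hl : IsReducedWord l w) (hl' : IsReducedWord l' w) :
    (l.map T).prod = (l'.map T).prod := by
  rw [isReducedWord_iff] at hl hl'
  induction hk : inversions w using Nat.strong_induction_on generalizing w l l' with
  | _ k ih =>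
    have last : ∀ {m : List (Fin (n - 1))} {i}, wordPerm (m ++ [i]) = w →
        (m ++ [i]).length = inversions w →
        w (hi i) < w (lo i) ∧ wordPerm m = w * simple i ∧
          m.length = inversions (w * simple i) := by
      intro m i h1 h2
      have h3 : wordPerm m = w * simple i := by
        rw [← h1, wordPerm_append, wordPerm_singleton, mul_assoc, simple_mul_self, mul_one]
      have h4 := inversions_wordPerm_le m
      rw [List.length_append, List.length_singleton] at h2
      rw [h3] at h4
      rcases lt_or_gt_of_ne (ne_of_descent w i) with h | h
      · rw [inversions_mul_simple h] at h4; omega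
      · have := inversions_mul_simple' h
        exact ⟨h, h3, by omega⟩
    have snoc : ∀ {m : List (Fin (n - 1))} {u : Equiv.Perm (Fin n)} {i}, wordPerm m = u * simple i →
        m.length = inversions (u * simple i) → u (hi i) < u (lo i) →
        wordPerm (m ++ [i]) = u ∧ (m ++ [i]).length = inversions u := by
      intro m u i h1 h2 h3
      constructor
      · rw [wordPerm_append, h1, wordPerm_singleton, mul_assoc, simple_mul_self, mul_one]
      · rw [List.length_append, List.length_singleton, h2, inversions_mul_simple' h3]
    -- A permutation with descents at i and j has a reduced word ending in the longest element of
    -- the subgroup generated by s_i and s_j. Each given word is compared with such a word by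
    -- induction, after removing the last letter; the two tails agree by a braid relation.
    have key : ∀ {m m' : List (Fin (n - 1))} {i j}, i ≤ j →
        wordPerm (m ++ [i]) = w ∧ (m ++ [i]).length = inversions w →
        wordPerm (m' ++ [j]) = w ∧ (m' ++ [j]).length = inversions w →
        ((m ++ [i]).map T).prod = ((m' ++ [j]).map T).prod := by
      intro m m' i j hij h h'
      obtain ⟨d, hm⟩ := last h.1 h.2
      obtain ⟨d', hm'⟩ := last h'.1 h'.2
      have hi1 := inversions_mul_simple' d
      have hj1 := inversions_mul_simple' d'
      rcases hij.eq_or_lt with rfl | hlt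
      · simp only [List.map_append, List.prod_append]
        rw [ih _ (by omega) hm hm' rfl]
      rcases (Nat.succ_le_of_lt hlt).eq_or_lt with hadj | hfar
      · have hadj : (i : ℕ) + 1 = j := hadj
        have e : lo j = hi i := by simp [lo, hi, hadj]
        have n1 : simple j (lo i) = lo i := simple_of_ne (by rw [e]; exact lo_ne_hi i)
          (by simp only [lo, hi, ne_eq, Fin.ext_iff]; omega)
        have n2 : simple i (hi j) = hi j := simple_of_ne
          (by simp only [lo, hi, ne_eq, Fin.ext_iff]; omega) (by rw [← e]; exact (lo_ne_hi j).symm)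
        have n3 : simple j (hi i) = hi j := by rw [← e, simple_lo]
        have n4 : simple i (lo j) = lo i := by rw [e, simple_hi]
        have d2 : w (hi j) < w (hi i) := by rw [← e]; exact d'
        have g1 : (w * simple i) (hi j) < (w * simple i) (lo j) := by
          simpa only [Equiv.Perm.mul_apply, n2, n4] using d2.trans d
        have g2 : (w * simple j) (hi i) < (w * simple j) (lo i) := by
          simpa only [Equiv.Perm.mul_apply, n1, n3] using d2.trans d
        have g3 : (w * simple i * simple j) (hi i) < (w * simple i * simple j) (lo i) := by
          simpa only [Equiv.Perm.mul_apply, n1, n2, n3, simple_lo] using d2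
        have g4 : (w * simple j * simple i) (hi j) < (w * simple j * simple i) (lo j) := by
          simpa only [Equiv.Perm.mul_apply, n1, n2, n4, simple_hi, e] using d
        -- `z` is the common prefix: it can be completed to `w` by s_i s_j s_i and equally by s_j
        -- s_i s_j.
        obtain ⟨z, hz⟩ := exists_word_length_eq_inversions (w * simple i * simple j * simple i)
        have hz' := hz
        rw [mul_assoc, mul_assoc, ← mul_assoc (simple i), simple_braid hadj, mul_assoc,
          ← mul_assoc w, ← mul_assoc (w * _)] at hz'
        have r1 := snoc hz.1 hz.2 g3
        have r2 := snoc r1.1 r1.2 g1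
        have r3 := snoc hz'.1 hz'.2 g4
        have r4 := snoc r3.1 r3.2 g2
        simp only [List.map_append, List.prod_append]
        rw [ih _ (by omega) hm r2 rfl, ih _ (by omega) hm' r4 rfl]
        simp only [List.map_append, List.prod_append, List.map_cons, List.map_nil,
          List.prod_singleton]
        rw [mul_assoc, mul_assoc, ← mul_assoc (T i), hbraid i j hadj]
        simp only [mul_assoc]
      · have hfar : (i : ℕ) + 1 < j := hfar
        have n1 : simple j (lo i) = lo i := simple_of_ne
          (by simp only [lo, ne_eq, Fin.ext_iff]; omega)
          (by simp only [lo, hi, ne_eq, Fin.ext_iff]; omega)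
        have n2 : simple j (hi i) = hi i := simple_of_ne
          (by simp only [lo, hi, ne_eq, Fin.ext_iff]; omega)
          (by simp only [hi, ne_eq, Fin.ext_iff]; omega)
        have n3 : simple i (lo j) = lo j := simple_of_ne
          (by simp only [lo, ne_eq, Fin.ext_iff]; omega)
          (by simp only [lo, hi, ne_eq, Fin.ext_iff]; omega)
        have n4 : simple i (hi j) = hi j := simple_of_ne
          (by simp only [lo, hi, ne_eq, Fin.ext_iff]; omega)
          (by simp only [hi, ne_eq, Fin.ext_iff]; omega)
        have g1 : (w * simple i) (hi j) < (w * simple i) (lo j) := by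
          simpa only [Equiv.Perm.mul_apply, n3, n4] using d'
        have g2 : (w * simple j) (hi i) < (w * simple j) (lo i) := by
          simpa only [Equiv.Perm.mul_apply, n1, n2] using d
        obtain ⟨z, hz⟩ := exists_word_length_eq_inversions (w * simple i * simple j)
        have hz' := hz
        rw [mul_assoc, simple_mul_simple_comm hfar, ← mul_assoc] at hz'
        have r1 := snoc hz.1 hz.2 g1
        have r2 := snoc hz'.1 hz'.2 g2
        simp only [List.map_append, List.prod_append]
        rw [ih _ (by omega) hm r1 rfl, ih _ (by omega) hm' r2 rfl]
        simp only [List.map_append, List.prod_append, List.map_cons, List.map_nil,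
          List.prod_singleton]
        rw [mul_assoc, mul_assoc, hcomm i j hfar]
    rcases l.eq_nil_or_concat' with rfl | ⟨m, i, rfl⟩
    · rcases l'.eq_nil_or_concat' with rfl | ⟨m', j, rfl⟩
      · rfl
      · simp [← hl.2] at hl'
    · rcases l'.eq_nil_or_concat' with rfl | ⟨m', j, rfl⟩
      · simp [← hl'.2] at hl
      · rcases le_total i j with hij | hij
        · exact key hij hl hl'
        · exact (key hij hl' hl).symm

/-! ### The longest element -/

theorem longest_apply (k : Fin n) : longest n k = k.rev := rfl

theorem rev_lo (i : Fin (n - 1)) : (lo i).rev = hi i.rev := by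
  have := i.2
  simp only [lo, hi, Fin.ext_iff, Fin.val_rev]; omega

theorem rev_hi (i : Fin (n - 1)) : (hi i).rev = lo i.rev := by
  have := i.2
  simp only [lo, hi, Fin.ext_iff, Fin.val_rev]; omega

theorem longest_mul_simple (i : Fin (n - 1)) :
    longest n * simple i = simple i.rev * longest n := by
  rw [simple, simple, Equiv.mul_swap_eq_swap_mul, longest_apply, longest_apply, rev_lo, rev_hi,
    Equiv.swap_comm]

theorem inversions_longest : inversions (longest n) = invCount (fun _ : Fin n => 0) := by
  unfold inversions invCount
  congr 1
  ext ⟨p, k⟩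
  simp only [longest_apply, Finset.mem_filter, Finset.mem_univ, true_and, le_refl, and_true,
    and_iff_left_iff_imp, Fin.val_rev, Fin.lt_def]
  intro h
  omega

theorem inversions_longest_succ : inversions (longest (n + 1)) = inversions (longest n) + n := by
  have h : (fun _ : Fin (n + 1) => 0) = (Fin.cons 0 fun _ => 0 : Fin (n + 1) → ℕ) := by
    funext k; refine Fin.cases ?_ (fun _ => ?_) k <;> simp
  rw [inversions_longest, inversions_longest, h, invCount_cons]
  simp [add_comm]

end Combinatorics

/-! ### Reduced words of the longest element -/

section LongestWords

variable {n : ℕ}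

/-- Here `lo` and `hi` serve as relabellings of letters: they send the letters of S_n to those of
the two copies of S_n in S_{n+1} that fix the last and the first position respectively. -/
theorem viaEmbedding_simple_castSucc (i : Fin (n - 1)) :
    Equiv.Perm.viaEmbeddingHom Fin.castSuccEmb (simple i) =
      simple (n := n + 1) (lo i) := by
  ext k
  refine Fin.lastCases ?_ (fun k => ?_) k
  · rw [Equiv.Perm.viaEmbeddingHom_apply, Equiv.Perm.viaEmbedding_apply_of_notMem, simple_of_ne]
    · exact (Fin.castSucc_lt_last (lo i)).ne'
    · exact (Fin.castSucc_lt_last (hi i)).ne'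
    · simp
  · rw [Equiv.Perm.viaEmbeddingHom_apply]
    rw [show k.castSucc = Fin.castSuccEmb k from rfl, Equiv.Perm.viaEmbedding_apply]
    exact congrArg Fin.val (Function.Embedding.swap_apply Fin.castSuccEmb _ _ _).symm

theorem viaEmbedding_simple_succ (i : Fin (n - 1)) :
    Equiv.Perm.viaEmbeddingHom (Fin.succEmb n) (simple i) =
      simple (n := n + 1) (hi i) := by
  ext k
  refine Fin.cases ?_ (fun k => ?_) k
  · rw [Equiv.Perm.viaEmbeddingHom_apply, Equiv.Perm.viaEmbedding_apply_of_notMem, simple_of_ne]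
    · exact (Fin.succ_ne_zero (lo i)).symm
    · exact (Fin.succ_ne_zero (hi i)).symm
    · simp
  · rw [Equiv.Perm.viaEmbeddingHom_apply]
    rw [show k.succ = (Fin.succEmb n) k from rfl, Equiv.Perm.viaEmbedding_apply]
    exact congrArg Fin.val (Function.Embedding.swap_apply (Fin.succEmb n) _ _ _).symm

theorem wordPerm_map_lo (l : List (Fin (n - 1))) :
    wordPerm (n := n + 1) (l.map lo) =
      Equiv.Perm.viaEmbeddingHom Fin.castSuccEmb (wordPerm l) := by
  induction l with
  | nil => exact (map_one _).symm
  | cons i l ih =>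
    rw [List.map_cons, wordPerm_cons, wordPerm_cons, map_mul, viaEmbedding_simple_castSucc, ih]

theorem wordPerm_map_hi (l : List (Fin (n - 1))) :
    wordPerm (n := n + 1) (l.map hi) =
      Equiv.Perm.viaEmbeddingHom (Fin.succEmb n) (wordPerm l) := by
  induction l with
  | nil => exact (map_one _).symm
  | cons i l ih =>
    rw [List.map_cons, wordPerm_cons, wordPerm_cons, map_mul, viaEmbedding_simple_succ, ih]

theorem wordPerm_map_lo_castSucc (l : List (Fin (n - 1))) (k : Fin n) :
    wordPerm (n := n + 1) (l.map lo) k.castSucc = (wordPerm l k).castSucc := by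
  rw [wordPerm_map_lo]
  exact Equiv.Perm.viaEmbedding_apply _ Fin.castSuccEmb k

theorem wordPerm_map_lo_last (l : List (Fin (n - 1))) :
    wordPerm (n := n + 1) (l.map lo) (Fin.last n) = Fin.last n := by
  rw [wordPerm_map_lo]
  exact Equiv.Perm.viaEmbedding_apply_of_notMem _ Fin.castSuccEmb _ (by simp)

theorem wordPerm_map_hi_succ (l : List (Fin (n - 1))) (k : Fin n) :
    wordPerm (n := n + 1) (l.map hi) k.succ = (wordPerm l k).succ := by
  rw [wordPerm_map_hi]
  exact Equiv.Perm.viaEmbedding_apply _ (Fin.succEmb n) k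

theorem wordPerm_map_hi_zero (l : List (Fin (n - 1))) :
    wordPerm (n := n + 1) (l.map hi) 0 = 0 := by
  rw [wordPerm_map_hi]
  exact Equiv.Perm.viaEmbedding_apply_of_notMem _ (Fin.succEmb n) _ (by simp)

theorem wordPerm_finRange (n : ℕ) :
    wordPerm (n := n + 1) (List.finRange n) (Fin.last n) = 0 ∧
      ∀ k : Fin n, wordPerm (n := n + 1) (List.finRange n) k.castSucc = k.succ := by
  induction n with
  | zero => exact ⟨rfl, fun k => k.elim0⟩
  | succ n ih =>
    have h : wordPerm (n := n + 2) (List.finRange (n + 1)) =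
        simple (n := n + 2) (0 : Fin (n + 1)) *
          wordPerm (n := n + 2) ((List.finRange n).map (hi (n := n + 1))) := by
      rw [List.finRange_succ]
      exact wordPerm_cons _ _
    rw [h]
    constructor
    · rw [Equiv.Perm.mul_apply, ← Fin.succ_last, wordPerm_map_hi_succ, ih.1]
      exact simple_hi (n := n + 2) (0 : Fin (n + 1))
    · intro k
      rw [Equiv.Perm.mul_apply]
      refine Fin.cases ?_ (fun k => ?_) k
      · rw [Fin.castSucc_zero, wordPerm_map_hi_zero]
        exact simple_lo (n := n + 2) (0 : Fin (n + 1))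
      · rw [← Fin.succ_castSucc, wordPerm_map_hi_succ, ih.2]
        refine simple_of_ne ?_ ?_
        · exact Fin.succ_ne_zero _
        · intro h
          exact Fin.succ_ne_zero _ (Fin.succ_injective _ h)

theorem wordPerm_reverse (l : List (Fin (n - 1))) : wordPerm l.reverse = (wordPerm l)⁻¹ := by
  induction l with
  | nil => simp
  | cons i l ih =>
    rw [List.reverse_cons, wordPerm_append, ih, wordPerm_singleton, wordPerm_cons, mul_inv_rev]
    simp [simple]

/-- The cycle s_n⋯s_1 moves the first position to the end, and the smaller longest element reverses
the rest; the lengths add up. This factorisation and its mirror image are matched in the affine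
step, where `unshift` turns `lo` letters into `hi` letters. -/
theorem isReducedWord_longest_succ_right {l : List (Fin (n - 1))}
    (h : IsReducedWord l (longest n)) :
    IsReducedWord (n := n + 1) (l.map lo ++ (List.finRange n).reverse) (longest (n + 1)) := by
  rw [isReducedWord_iff] at h ⊢
  constructor
  · refine (wordPerm_append (n := n + 1) _ _).trans ?_
    rw [wordPerm_reverse (n := n + 1), mul_inv_eq_iff_eq_mul]
    ext k
    refine Fin.lastCases ?_ (fun k => ?_) k
    · rw [wordPerm_map_lo_last, Equiv.Perm.mul_apply, (wordPerm_finRange n).1, longest_apply,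
        Fin.rev_zero]
    · rw [wordPerm_map_lo_castSucc, Equiv.Perm.mul_apply, (wordPerm_finRange n).2, longest_apply,
        h.1, longest_apply, Fin.rev_succ]
  · rw [List.length_append, List.length_map, List.length_reverse, List.length_finRange, h.2,
      inversions_longest_succ]

theorem isReducedWord_longest_succ_left {l : List (Fin (n - 1))}
    (h : IsReducedWord l (longest n)) :
    IsReducedWord (n := n + 1) (l.map hi ++ List.finRange n) (longest (n + 1)) := by
  rw [isReducedWord_iff] at h ⊢
  constructor
  · refine (wordPerm_append (n := n + 1) _ _).trans ?_
    ext k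
    refine Fin.lastCases ?_ (fun k => ?_) k
    · rw [Equiv.Perm.mul_apply, (wordPerm_finRange n).1, wordPerm_map_hi_zero, longest_apply,
        Fin.rev_last]
    · rw [Equiv.Perm.mul_apply, (wordPerm_finRange n).2, wordPerm_map_hi_succ, longest_apply,
        h.1, longest_apply, Fin.rev_castSucc]
  · rw [List.length_append, List.length_map, List.length_finRange, h.2,
      inversions_longest_succ]

/-- In a monoid with elements satisfying the braid relations, the element attached to the longest
permutation intertwines the generators with the reversed generators. -/
theorem prod_map_mul_of_longest {M : Type*} [Monoid M] (T : Fin (n - 1) → M)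
    (hcomm : ∀ i j : Fin (n - 1), (i : ℕ) + 1 < j → T i * T j = T j * T i)
    (hbraid : ∀ i j : Fin (n - 1), (i : ℕ) + 1 = j → T i * T j * T i = T j * T i * T j)
    {l : List (Fin (n - 1))} (hl : IsReducedWord l (longest n)) (i : Fin (n - 1)) :
    (l.map T).prod * T i = T i.rev * (l.map T).prod := by
  have d : longest n (hi i) < longest n (lo i) := by
    simp only [longest_apply]
    exact Fin.rev_lt_rev.2 (lo_lt_hi i)
  have h1 := inversions_mul_simple' d
  -- Because w₀ s_i = s_{i.rev} w₀, one word `m` for this element extends to a reduced word of w₀ on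
  -- either side.
  obtain ⟨m, hm, hlen⟩ := exists_word_length_eq_inversions (longest n * simple i)
  have r1 : IsReducedWord (m ++ [i]) (longest n) := by
    rw [isReducedWord_iff, wordPerm_append, hm, wordPerm_singleton, mul_assoc, simple_mul_self,
      mul_one, List.length_append, List.length_singleton, hlen]
    exact ⟨rfl, h1⟩
  have r2 : IsReducedWord (i.rev :: m) (longest n) := by
    rw [isReducedWord_iff, wordPerm_cons, hm, longest_mul_simple, ← mul_assoc, simple_mul_self,
      one_mul, List.length_cons, hlen]
    exact ⟨rfl, h1⟩
  have e1 := prod_map_eq_of_braid T hcomm hbraid hl r1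
  have e2 := prod_map_eq_of_braid T hcomm hbraid hl r2
  rw [List.map_append, List.prod_append, List.map_singleton, List.prod_singleton] at e1
  rw [List.map_cons, List.prod_cons] at e2
  nth_rewrite 1 [e2]
  rw [e1, mul_assoc]

end LongestWords

open MvPolynomial

section Operators

variable {n : ℕ}

/-! ### Demazure–Lusztig operators on polynomials -/

/-- The `f` fixed by `φ` modulo `A` form a subalgebra, so the variables suffice. This yields the
divided differences, the factor theorem and the congruence for the affine shift. -/
theorem dvd_sub_map_of_forall_X {σ R : Type*} [CommRing R] {A : MvPolynomial σ R}
    (φ : MvPolynomial σ R →ₐ[R] MvPolynomial σ R) (h : ∀ k, A ∣ X k - φ (X k))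
    (f : MvPolynomial σ R) : A ∣ f - φ f := by
  induction f using MvPolynomial.induction_on with
  | C a => simp [← algebraMap_eq]
  | add f g hf hg =>
    rw [map_add, add_sub_add_comm]
    exact dvd_add hf hg
  | mul_X f k hf =>
    rw [map_mul, show f * X k - φ f * φ (X k) = (f - φ f) * X k + φ f * (X k - φ (X k)) by ring]
    exact dvd_add (hf.mul_right _) ((h k).mul_left _)

theorem dvd_sub_rename_simple (i : Fin (n - 1)) (f : PolyRing n) :
    (X (lo i) - X (hi i) : PolyRing n) ∣ f - rename (simple i) f := by
  refine dvd_sub_map_of_forall_X _ (fun k => ?_) f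
  rw [rename_X]
  by_cases h1 : k = lo i
  · rw [h1, simple_lo]
  by_cases h2 : k = hi i
  · rw [h2, simple_hi]
    exact ⟨-1, by ring⟩
  · rw [simple_of_ne h1 h2, sub_self]
    exact dvd_zero _

theorem X_lo_sub_X_hi_ne_zero (i : Fin (n - 1)) : (X (lo i) - X (hi i) : PolyRing n) ≠ 0 :=
  sub_ne_zero.2 fun h => lo_ne_hi i (X_injective h)

/-- The divided difference `(f - s_i f) / (x_i - x_{i+1})`. -/
def divDiff (i : Fin (n - 1)) (f : PolyRing n) : PolyRing n :=
  (dvd_sub_rename_simple i f).choose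

theorem mul_divDiff (i : Fin (n - 1)) (f : PolyRing n) :
    (X (lo i) - X (hi i)) * divDiff i f = f - rename (simple i) f :=
  (dvd_sub_rename_simple i f).choose_spec.symm

/-- The Demazure–Lusztig operator with parameter `s` on polynomials. -/
def demLus (s : BaseField) (i : Fin (n - 1)) : Module.End BaseField (PolyRing n) where
  toFun f := C s * rename (simple i) f - C (1 - s) * X (lo i) * divDiff i f
  map_add' f g := by
    apply mul_left_cancel₀ (X_lo_sub_X_hi_ne_zero i)
    have h1 := mul_divDiff i f
    have h2 := mul_divDiff i g
    have h3 := mul_divDiff i (f + g)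
    rw [map_add] at h3 ⊢
    linear_combination C (1 - s) * X (lo i) * (h1 + h2 - h3)
  map_smul' c f := by
    apply mul_left_cancel₀ (X_lo_sub_X_hi_ne_zero i)
    have h1 := mul_divDiff i f
    have h3 := mul_divDiff i (c • f)
    rw [map_smul, smul_eq_C_mul, smul_eq_C_mul] at h3
    rw [map_smul, RingHom.id_apply, smul_eq_C_mul, smul_eq_C_mul, smul_eq_C_mul]
    linear_combination C (1 - s) * X (lo i) * (C c * h1 - h3)

/-- Cleared of its denominator, this equation determines the operator, so operator identities reduce
to polynomial identities. It also displays the factor x_i - s x_{i+1} on which the vanishing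
argument depends. -/
theorem mul_demLus (s : BaseField) (i : Fin (n - 1)) (f : PolyRing n) :
    (X (lo i) - X (hi i)) * demLus s i f =
      (X (lo i) - C s * X (hi i)) * rename (simple i) f - C (1 - s) * X (lo i) * f := by
  have h := mul_divDiff i f
  have hC : (C (1 - s) : PolyRing n) = 1 - C s := by simp
  simp only [demLus, LinearMap.coe_mk, AddHom.coe_mk]
  rw [hC]
  linear_combination -(1 - C s) * X (lo i) * h

theorem demLus_eq_of_mul_eq {s : BaseField} {i : Fin (n - 1)} {f g : PolyRing n}
    (h : (X (lo i) - X (hi i)) * g =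
      (X (lo i) - C s * X (hi i)) * rename (simple i) f - C (1 - s) * X (lo i) * f) :
    demLus s i f = g :=
  mul_left_cancel₀ (X_lo_sub_X_hi_ne_zero i) ((mul_demLus s i f).trans h.symm)

theorem rename_simple_rename_simple (i : Fin (n - 1)) (f : PolyRing n) :
    rename (simple i) (rename (simple i) f) = f := by
  rw [rename_rename, show ⇑(simple i) ∘ ⇑(simple i) = id from funext fun k => simple_simple i k,
    rename_id_apply]

theorem mul_rename_demLus (s : BaseField) (i : Fin (n - 1)) (f : PolyRing n) :
    (X (hi i) - X (lo i)) * rename (simple i) (demLus s i f) =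
      (X (hi i) - C s * X (lo i)) * f - C (1 - s) * X (hi i) * rename (simple i) f := by
  have h := congrArg (rename (simple i)) (mul_demLus s i f)
  simpa only [map_sub, map_mul, rename_X, rename_C, simple_lo, simple_hi,
    rename_simple_rename_simple] using h

/-- A ring homomorphism which is compatible with the variables `x_i`, `x_{i+1}` up to a common
factor and with the transposition commutes with the Demazure–Lusztig operator. -/
theorem map_demLus {m : ℕ} (φ : PolyRing n →+* PolyRing m) {u : PolyRing m} (hu : u ≠ 0)
    {s s' : BaseField} {i : Fin (n - 1)} {j : Fin (m - 1)} (hlo : φ (X (lo i)) = u * X (lo j))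
    (hhi : φ (X (hi i)) = u * X (hi j)) (hs : φ (C s) = C s')
    (hφ : ∀ f, φ (rename (simple i) f) = rename (simple j) (φ f)) (f : PolyRing n) :
    φ (demLus s i f) = demLus s' j (φ f) := by
  refine (demLus_eq_of_mul_eq (mul_left_cancel₀ hu ?_)).symm
  have h := congrArg φ (mul_demLus s i f)
  have hC : ∀ k : ℕ, ∀ r : BaseField, (C (1 - r) : PolyRing k) = 1 - C r := by simp
  rw [hC] at h ⊢
  simp only [map_sub, map_mul, map_one, hlo, hhi, hs, hφ] at h
  linear_combination h

theorem demLus_mul_of_symm (s : BaseField) {i : Fin (n - 1)} {P : PolyRing n}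
    (hP : rename (simple i) P = P) (f : PolyRing n) :
    demLus s i (P * f) = P * demLus s i f := by
  apply demLus_eq_of_mul_eq
  rw [map_mul, hP]
  linear_combination P * mul_demLus s i f

/-- The quadratic Hecke relation (H_i - s)(H_i + 1) = 0; for s ≠ 0 it makes H_i invertible. -/
theorem demLus_demLus (s : BaseField) (i : Fin (n - 1)) (f : PolyRing n) :
    demLus s i (demLus s i f) = C (s - 1) * demLus s i f + C s * f := by
  apply demLus_eq_of_mul_eq
  apply mul_left_cancel₀ (X_lo_sub_X_hi_ne_zero i)
  have h1 := mul_demLus s i f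
  have h2 := mul_rename_demLus s i f
  simp only [map_sub, map_one] at h1 h2 ⊢
  linear_combination ((C s - 1) * (X (lo i) - X (hi i)) + (1 - C s) * X (lo i)) * h1 +
    (X (lo i) - C s * X (hi i)) * h2

/-- The affine Hecke relation between H_i and multiplication by the variables; iterated, it gives
`demLusWord_telescope`. -/
theorem demLus_X_hi_mul_demLus (s : BaseField) (i : Fin (n - 1)) (f : PolyRing n) :
    demLus s i (X (hi i) * demLus s i f) = C s * (X (lo i) * f) := by
  apply demLus_eq_of_mul_eq
  apply mul_left_cancel₀ (X_lo_sub_X_hi_ne_zero i)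
  have h1 := mul_demLus s i f
  have h2 := mul_rename_demLus s i f
  simp only [map_sub, map_one, map_mul, rename_X, simple_hi] at h1 h2 ⊢
  linear_combination ((1 - C s) * X (lo i) * X (hi i)) * h1 +
    X (lo i) * (X (lo i) - C s * X (hi i)) * h2

theorem demLus_injective {s : BaseField} (hs : s ≠ 0) (i : Fin (n - 1)) :
    Function.Injective (demLus (n := n) s i) := by
  rw [injective_iff_map_eq_zero]
  intro f hf
  have h := demLus_demLus s i f
  rw [hf, map_zero, mul_zero, zero_add] at h
  simpa [hs] using h.symm

theorem demLus_one (s : BaseField) (i : Fin (n - 1)) : demLus s i 1 = C s := by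
  apply demLus_eq_of_mul_eq
  simp only [map_sub, map_one]
  ring

/-- By the quadratic relation t H_j⁻¹ = H_j + 1 - t, so this says that conjugation by w₀ carries
H_i° to the inverse of H_{n-i}. -/
theorem rename_longest_demLus (i : Fin (n - 1)) (f : PolyRing n) :
    C t * rename (longest n) (demLus t⁻¹ i f) =
      demLus t i.rev (rename (longest n) f) + C (1 - t) * rename (longest n) f := by
  rw [← sub_eq_iff_eq_add]
  refine (demLus_eq_of_mul_eq ?_).symm
  have h := congrArg (rename (longest n)) (mul_demLus t⁻¹ i f)
  have hσ : rename (longest n) (rename (simple i) f) =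
      rename (simple i.rev) (rename (longest n) f) := by
    rw [rename_rename, rename_rename, ← Equiv.Perm.coe_mul, longest_mul_simple,
      Equiv.Perm.coe_mul]
  have ht : (C t * C t⁻¹ : PolyRing n) = 1 := by
    rw [← C_mul, mul_inv_cancel₀ t_ne_zero, C_1]
  simp only [map_sub, map_mul, map_one, rename_X, rename_C, longest_apply, rev_lo, rev_hi, hσ]
    at h ⊢
  linear_combination (-C t) * h + (X (lo i.rev) * rename (simple i.rev) (rename (longest n) f) -
    X (hi i.rev) * rename (longest n) f) * ht

theorem mul_eval_demLus (s : BaseField) (i : Fin (n - 1)) (v : Fin n → BaseField)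
    (f : PolyRing n) :
    (v (lo i) - v (hi i)) * eval v (demLus s i f) =
      (v (lo i) - s * v (hi i)) * eval (v ∘ simple i) f - (1 - s) * v (lo i) * eval v f := by
  have h := congrArg (eval v) (mul_demLus s i f)
  simpa [eval_rename] using h

/-! ### The braid relations -/

/-- The two triple products written out in a field, with a, b, c the three variables involved. A
digit string after f, p or r records the transpositions applied: p = H_i f, r = H_j p, u = H_i r,
and the primed letters belong to the other product, which starts with H_j. Elimination of the
intermediate values leaves one rational identity. -/
theorem braid_identity {L : Type*} [Field L] {a b c s : L} (hab : a - b ≠ 0) (hac : a - c ≠ 0)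
    (hbc : b - c ≠ 0) {f f1 f2 f12 f21 f121 p p1 p2 p12 r r1 u p' p2' p1' p21' r' r2' u' : L}
    (hp : (a - b) * p = (a - s * b) * f1 - (1 - s) * a * f)
    (hp1 : (b - a) * p1 = (b - s * a) * f - (1 - s) * b * f1)
    (hp2 : (a - c) * p2 = (a - s * c) * f21 - (1 - s) * a * f2)
    (hp12 : (b - c) * p12 = (b - s * c) * f121 - (1 - s) * b * f12)
    (hr : (b - c) * r = (b - s * c) * p2 - (1 - s) * b * p)
    (hr1 : (a - c) * r1 = (a - s * c) * p12 - (1 - s) * a * p1)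
    (hu : (a - b) * u = (a - s * b) * r1 - (1 - s) * a * r)
    (hp' : (b - c) * p' = (b - s * c) * f2 - (1 - s) * b * f)
    (hp2' : (c - b) * p2' = (c - s * b) * f - (1 - s) * c * f2)
    (hp1' : (a - c) * p1' = (a - s * c) * f12 - (1 - s) * a * f1)
    (hp21' : (a - b) * p21' = (a - s * b) * f121 - (1 - s) * a * f21)
    (hr' : (a - b) * r' = (a - s * b) * p1' - (1 - s) * a * p')
    (hr2' : (a - c) * r2' = (a - s * c) * p21' - (1 - s) * a * p2')
    (hu' : (b - c) * u' = (b - s * c) * r2' - (1 - s) * b * r') : u = u' := by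
  have hba : b - a ≠ 0 := by rw [← neg_sub]; exact neg_ne_zero.2 hab
  have hcb : c - b ≠ 0 := by rw [← neg_sub]; exact neg_ne_zero.2 hbc
  obtain rfl := eq_div_of_mul_eq hab ((mul_comm _ _).trans hp)
  have hp1 : p1 = -((b - s * a) * f - (1 - s) * b * f1) / (a - b) := by
    rw [eq_div_iff hab]; linear_combination -hp1
  subst hp1
  obtain rfl := eq_div_of_mul_eq hac ((mul_comm _ _).trans hp2)
  obtain rfl := eq_div_of_mul_eq hbc ((mul_comm _ _).trans hp12)
  obtain rfl := eq_div_of_mul_eq hbc ((mul_comm _ _).trans hr)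
  obtain rfl := eq_div_of_mul_eq hac ((mul_comm _ _).trans hr1)
  obtain rfl := eq_div_of_mul_eq hab ((mul_comm _ _).trans hu)
  obtain rfl := eq_div_of_mul_eq hbc ((mul_comm _ _).trans hp')
  have hp2' : p2' = -((c - s * b) * f - (1 - s) * c * f2) / (b - c) := by
    rw [eq_div_iff hbc]; linear_combination -hp2'
  subst hp2'
  obtain rfl := eq_div_of_mul_eq hac ((mul_comm _ _).trans hp1')
  obtain rfl := eq_div_of_mul_eq hab ((mul_comm _ _).trans hp21')
  obtain rfl := eq_div_of_mul_eq hab ((mul_comm _ _).trans hr')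
  obtain rfl := eq_div_of_mul_eq hac ((mul_comm _ _).trans hr2')
  obtain rfl := eq_div_of_mul_eq hbc ((mul_comm _ _).trans hu')
  field_simp
  ring

theorem demLus_braid (s : BaseField) {i j : Fin (n - 1)} (h : (i : ℕ) + 1 = j) :
    demLus (n := n) s i * demLus s j * demLus s i = demLus s j * demLus s i * demLus s j := by
  have e : lo j = hi i := by simp [lo, hi, h]
  have n1 : simple j (lo i) = lo i := simple_of_ne (by rw [e]; exact lo_ne_hi i)
    (by simp only [lo, hi, ne_eq, Fin.ext_iff]; omega)
  have n2 : simple i (hi j) = hi j := simple_of_ne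
    (by simp only [lo, hi, ne_eq, Fin.ext_iff]; omega) (by rw [← e]; exact (lo_ne_hi j).symm)
  have n3 : simple j (hi i) = hi j := by rw [← e, simple_lo]
  have n5 : simple j (hi j) = hi i := by rw [simple_hi, e]
  refine LinearMap.ext fun f => ?_
  simp only [Module.End.mul_apply]
  apply IsFractionRing.injective (PolyRing n) (RatFun n)
  have ne : ∀ {k l : Fin n}, k ≠ l →
      algebraMap (PolyRing n) (RatFun n) (X k) - algebraMap (PolyRing n) (RatFun n) (X l) ≠ 0 := by
    intro k l hkl
    rw [← map_sub, map_ne_zero_iff _ (IsFractionRing.injective (PolyRing n) (RatFun n))]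
    exact sub_ne_zero.2 fun h => hkl (X_injective h)
  have hC : (C (1 - s) : PolyRing n) = 1 - C s := by simp
  have hst : rename (simple i) (rename (simple j) (rename (simple i) f)) =
      rename (simple j) (rename (simple i) (rename (simple j) f)) := by
    have h' := simple_braid h
    rw [mul_assoc, mul_assoc] at h'
    simp only [rename_rename, ← Equiv.Perm.coe_mul]
    rw [h']
  have hac : lo i ≠ hi j := by simp only [lo, hi, ne_eq, Fin.ext_iff]; omega
  have hbc : hi i ≠ hi j := by rw [← e]; exact lo_ne_hi j
  have hm : ∀ {P Q : PolyRing n}, P = Q →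
      algebraMap (PolyRing n) (RatFun n) P = algebraMap (PolyRing n) (RatFun n) Q :=
    fun h => congrArg _ h
  have hp := mul_demLus s i f
  have hp1 := mul_rename_demLus s i f
  have hp2 := congrArg (rename (simple j)) hp
  have hp12 := congrArg (rename (simple i)) hp2
  have hr := mul_demLus s j (demLus s i f)
  have hr1 := congrArg (rename (simple i)) hr
  have hu := mul_demLus s i (demLus s j (demLus s i f))
  have hp' := mul_demLus s j f
  have hp2' := mul_rename_demLus s j f
  have hp1' := congrArg (rename (simple i)) hp'
  have hp21' := congrArg (rename (simple j)) hp1'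
  have hr' := mul_demLus s i (demLus s j f)
  have hr2' := congrArg (rename (simple j)) hr'
  have hu' := mul_demLus s j (demLus s i (demLus s j f))
  simp only [map_sub, map_mul, map_one, rename_X, rename_C, simple_lo, simple_hi, hC, n1, n2, n3,
    n5, e] at hp hp1 hp2 hp12 hr hr1 hu hp' hp2' hp1' hp21' hr' hr2' hu'
  rw [← hst] at hp21'
  exact braid_identity (ne (lo_ne_hi i)) (ne hac) (ne hbc)
    (s := algebraMap (PolyRing n) (RatFun n) (C s))
    (by simpa only [map_sub, map_mul, map_one] using hm hp)
    (by simpa only [map_sub, map_mul, map_one] using hm hp1)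
    (by simpa only [map_sub, map_mul, map_one] using hm hp2)
    (by simpa only [map_sub, map_mul, map_one] using hm hp12)
    (by simpa only [map_sub, map_mul, map_one] using hm hr)
    (by simpa only [map_sub, map_mul, map_one] using hm hr1)
    (by simpa only [map_sub, map_mul, map_one] using hm hu)
    (by simpa only [map_sub, map_mul, map_one] using hm hp')
    (by simpa only [map_sub, map_mul, map_one] using hm hp2')
    (by simpa only [map_sub, map_mul, map_one] using hm hp1')
    (by simpa only [map_sub, map_mul, map_one] using hm hp21')
    (by simpa only [map_sub, map_mul, map_one] using hm hr')
    (by simpa only [map_sub, map_mul, map_one] using hm hr2')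
    (by simpa only [map_sub, map_mul, map_one] using hm hu')

theorem simple_fix_of_far {i j : Fin (n - 1)} (h : (i : ℕ) + 1 < j ∨ (j : ℕ) + 1 < i) :
    simple j (lo i) = lo i ∧ simple j (hi i) = hi i := by
  constructor <;> refine simple_of_ne ?_ ?_ <;> simp only [lo, hi, ne_eq, Fin.ext_iff] <;> omega

theorem demLus_comm (s : BaseField) {i j : Fin (n - 1)} (h : (i : ℕ) + 1 < j) :
    demLus (n := n) s i * demLus s j = demLus s j * demLus s i := by
  obtain ⟨h1, h2⟩ := simple_fix_of_far (Or.inl h)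
  obtain ⟨h3, h4⟩ := simple_fix_of_far (Or.inr h)
  refine LinearMap.ext fun f => ?_
  simp only [Module.End.mul_apply]
  apply demLus_eq_of_mul_eq
  have hσ : rename (simple i) (demLus s j f) = demLus s j (rename (simple i) f) := by
    refine map_demLus (rename (simple i)).toRingHom (u := 1) one_ne_zero ?_ ?_ ?_ ?_ f
    · simp [h3]
    · simp [h4]
    · simp
    · intro f
      simp only [AlgHom.toRingHom_eq_coe, RingHom.coe_coe, rename_rename, ← Equiv.Perm.coe_mul]
      rw [simple_mul_simple_comm h]
  rw [hσ, ← demLus_mul_of_symm s (i := j) (by simp [h1, h2]), mul_demLus, map_sub,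
    demLus_mul_of_symm s (i := j) (by simp [h1, h2]), demLus_mul_of_symm s (i := j) (by simp [h1])]

/-- The product of Demazure–Lusztig operators on polynomials given by a word. -/
def demLusWord (s : BaseField) (l : List (Fin (n - 1))) : Module.End BaseField (PolyRing n) :=
  (l.map (demLus s)).prod

@[simp] theorem demLusWord_nil (s : BaseField) (f : PolyRing n) : demLusWord s [] f = f := rfl

@[simp] theorem demLusWord_cons (s : BaseField) (i : Fin (n - 1)) (l : List (Fin (n - 1)))
    (f : PolyRing n) : demLusWord s (i :: l) f = demLus s i (demLusWord s l f) := by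
  simp [demLusWord]

@[simp] theorem demLusWord_append (s : BaseField) (l l' : List (Fin (n - 1)))
    (f : PolyRing n) : demLusWord s (l ++ l') f = demLusWord s l (demLusWord s l' f) := by
  simp [demLusWord]

theorem demLusWord_eq_of_isReducedWord (s : BaseField) {w : Equiv.Perm (Fin n)}
    {l l' : List (Fin (n - 1))} (hl : IsReducedWord l w) (hl' : IsReducedWord l' w) :
    demLusWord (n := n) s l = demLusWord s l' :=
  prod_map_eq_of_braid _ (fun _ _ h => demLus_comm s h) (fun _ _ h => demLus_braid s h) hl hl'

theorem demLusWord_demLus_of_longest (s : BaseField) {l : List (Fin (n - 1))}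
    (hl : IsReducedWord l (longest n)) (i : Fin (n - 1)) (f : PolyRing n) :
    demLusWord s l (demLus s i f) = demLus s i.rev (demLusWord s l f) :=
  LinearMap.congr_fun (prod_map_mul_of_longest _ (fun _ _ h => demLus_comm s h)
    (fun _ _ h => demLus_braid s h) hl i) f

theorem demLusWord_one (s : BaseField) (l : List (Fin (n - 1))) :
    demLusWord s l 1 = C (s ^ l.length) := by
  induction l with
  | nil => simp
  | cons i l ih =>
    rw [demLusWord_cons, ih, ← mul_one (C _), demLus_mul_of_symm _ (by simp), demLus_one, ← C_mul,
      List.length_cons, pow_succ]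

theorem demLusWord_injective {s : BaseField} (hs : s ≠ 0) (l : List (Fin (n - 1))) :
    Function.Injective (demLusWord (n := n) s l) := by
  induction l with
  | nil => exact fun _ _ h => h
  | cons i l ih =>
    intro f g h
    rw [demLusWord_cons, demLusWord_cons] at h
    exact ih (demLus_injective hs i h)

/-! ### Comparison with the operators on rational functions -/

theorem permute_algebraMap (w : Equiv.Perm (Fin n)) (f : PolyRing n) :
    permute w (algebraMap (PolyRing n) (RatFun n) f) =
      algebraMap (PolyRing n) (RatFun n) (rename w f) := by
  unfold permute
  exact (IsFractionRing.liftAlgHom_apply _ _).trans (IsFractionRing.lift_algebraMap _ f)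

theorem demazureLusztig_algebraMap (s : BaseField) (i : Fin (n - 1)) (f : PolyRing n) :
    demazureLusztig s i (algebraMap (PolyRing n) (RatFun n) f) =
      algebraMap (PolyRing n) (RatFun n) (demLus s i f) := by
  have ne : algebraMap (PolyRing n) (RatFun n) (X (lo i)) -
      algebraMap (PolyRing n) (RatFun n) (X (hi i)) ≠ 0 := by
    rw [← map_sub, map_ne_zero_iff _ (IsFractionRing.injective (PolyRing n) (RatFun n))]
    exact X_lo_sub_X_hi_ne_zero i
  have h := congrArg (algebraMap (PolyRing n) (RatFun n)) (mul_divDiff i f)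
  rw [map_mul, map_sub, map_sub] at h
  have hc : ∀ c : BaseField, algebraMap BaseField (RatFun n) c =
      algebraMap (PolyRing n) (RatFun n) (C c) := fun c =>
    IsScalarTower.algebraMap_apply BaseField (PolyRing n) (RatFun n) c
  simp only [demazureLusztig, demLus, LinearMap.sub_apply, LinearMap.smul_apply,
    AlgHom.toLinearMap_apply, permute_algebraMap, Module.End.mul_apply, LinearMap.mulLeft_apply,
    Module.End.one_apply, LinearMap.coe_mk, AddHom.coe_mk, map_sub, map_mul]
  rw [eq_div_of_mul_eq ne ((mul_comm _ _).trans h), Algebra.smul_def]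
  simp only [hc, x]
  ring

theorem heckeWord_algebraMap (s : BaseField) (l : List (Fin (n - 1))) (f : PolyRing n) :
    heckeWord s l (algebraMap (PolyRing n) (RatFun n) f) =
      algebraMap (PolyRing n) (RatFun n) (demLusWord s l f) := by
  induction l with
  | nil => rfl
  | cons i l ih =>
    rw [demLusWord_cons, ← demazureLusztig_algebraMap, ← ih]
    rfl

end Operators

/-! ### The ground field and its involution -/

theorem q_pow_mul_t_pow_injective {a b c d : ℕ} (h : q ^ a * t ^ b = q ^ c * t ^ d) :
    a = c ∧ b = d := by
  have h1 : (X 0 ^ a * X 1 ^ b : MvPolynomial (Fin 2) ℚ) = X 0 ^ c * X 1 ^ d := by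
    apply IsFractionRing.injective (MvPolynomial (Fin 2) ℚ) BaseField
    rw [map_mul, map_mul, map_pow, map_pow, map_pow, map_pow]
    exact h
  rw [X_pow_eq_monomial, X_pow_eq_monomial, X_pow_eq_monomial, X_pow_eq_monomial, monomial_mul,
    monomial_mul, mul_one] at h1
  have h2 := monomial_left_injective one_ne_zero h1
  have e0 := DFunLike.congr_fun h2 0
  have e1 := DFunLike.congr_fun h2 1
  simp at e0 e1
  exact ⟨e0, e1⟩

theorem q_zpow_mul_t_zpow_injective {a b c d : ℤ} (h : q ^ a * t ^ b = q ^ c * t ^ d) :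
    a = c ∧ b = d := by
  have hq := q_ne_zero
  have ht := t_ne_zero
  -- Any `k` that makes all four shifted exponents nonnegative would do.
  obtain ⟨k, hk⟩ : ∃ k : ℤ, k = |a| + |b| + |c| + |d| := ⟨_, rfl⟩
  have ha := neg_abs_le a
  have hb := neg_abs_le b
  have hc := neg_abs_le c
  have hd := neg_abs_le d
  have ha' := abs_nonneg a
  have hb' := abs_nonneg b
  have hc' := abs_nonneg c
  have hd' := abs_nonneg d
  have h1 : q ^ (a + k).toNat * t ^ (b + k).toNat = q ^ (c + k).toNat * t ^ (d + k).toNat := by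
    rw [← zpow_natCast, ← zpow_natCast, ← zpow_natCast, ← zpow_natCast,
      Int.toNat_of_nonneg (by omega), Int.toNat_of_nonneg (by omega),
      Int.toNat_of_nonneg (by omega), Int.toNat_of_nonneg (by omega), zpow_add₀ hq, zpow_add₀ ht,
      zpow_add₀ hq c, zpow_add₀ ht d]
    linear_combination q ^ k * t ^ k * h
  obtain ⟨e1, e2⟩ := q_pow_mul_t_pow_injective h1
  constructor <;> omega

theorem iota_iota (c : BaseField) : iota (iota c) = c := by
  have h : iota.comp iota = RingHom.id BaseField := by
    apply IsLocalization.ringHom_ext (nonZeroDivisors (MvPolynomial (Fin 2) ℚ))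
    apply MvPolynomial.ringHom_ext
    · intro r
      have h : ∀ r : ℚ, algebraMap (MvPolynomial (Fin 2) ℚ) BaseField (C r) = (r : BaseField) := by
        intro r
        exact eq_ratCast ((algebraMap (MvPolynomial (Fin 2) ℚ) BaseField).comp C) r
      simp [h]
    · intro i
      have e : ∀ i, algebraMap (MvPolynomial (Fin 2) ℚ) BaseField (X i) = ![q, t] i := by
        intro i; fin_cases i <;> rfl
      simp only [RingHom.comp_apply, RingHom.id_apply, e]
      fin_cases i <;> simp [iota_q, iota_t]
  exact RingHom.congr_fun h c

/-! ### The semilinear involution attached to ι -/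

section Circ

variable {n : ℕ}

theorem circ_circ (f : PolyRing n) : circ (circ f) = f := by
  rw [circ, circ, map_map, show iota.comp iota = RingHom.id BaseField from RingHom.ext iota_iota,
    map_id]

theorem scale_scale (c d : BaseField) (f : PolyRing n) : scale c (scale d f) = scale (c * d) f := by
  simp only [scale, bind₁_bind₁]
  congr 1
  refine congrArg _ (funext fun i => ?_)
  rw [map_mul, bind₁_C_right, bind₁_X_right, C_mul]
  ring

theorem scale_one (f : PolyRing n) : scale 1 f = f := by
  simp [scale, bind₁_X_left]

theorem circ_scale (c : BaseField) (f : PolyRing n) :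
    circ (scale c f) = scale (iota c) (circ f) := by
  simp only [circ, scale, map_bind₁]
  congr 1
  refine congrArg _ (funext fun i => ?_)
  simp

/-- The semilinear involution `f ↦ f°(t^(n-1) x)`. -/
def dual (f : PolyRing n) : PolyRing n := scale (t ^ ((n : ℤ) - 1)) (circ f)

/-- `dual` as a ring homomorphism. -/
def dualHom (n : ℕ) : PolyRing n →+* PolyRing n :=
  (bind₁ fun i => C (t ^ ((n : ℤ) - 1)) * X i : PolyRing n →ₐ[BaseField] PolyRing n).toRingHom.comp
    (MvPolynomial.map iota)

theorem dual_dual (f : PolyRing n) : dual (dual f) = f := by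
  rw [dual, dual, circ_scale, circ_circ, scale_scale, map_zpow₀, iota_t, inv_zpow,
    mul_inv_cancel₀ (zpow_ne_zero _ t_ne_zero), scale_one]

theorem dual_sub (f g : PolyRing n) : dual (f - g) = dual f - dual g := by
  simp [dual, circ, scale]

theorem dual_C_mul (c : BaseField) (f : PolyRing n) : dual (C c * f) = C (iota c) * dual f := by
  simp [dual, circ, scale]

theorem circ_rename (w : Equiv.Perm (Fin n)) (f : PolyRing n) :
    circ (rename w f) = rename w (circ f) := map_rename _ _ _

theorem scale_rename (c : BaseField) (w : Equiv.Perm (Fin n)) (f : PolyRing n) :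
    scale c (rename w f) = rename w (scale c f) := by
  simp only [scale, bind₁_rename, rename_bind₁]
  congr 1
  refine congrArg _ (funext fun i => ?_)
  simp

theorem dual_rename (w : Equiv.Perm (Fin n)) (f : PolyRing n) :
    dual (rename w f) = rename w (dual f) := by
  rw [dual, circ_rename, scale_rename, dual]

theorem dual_demLus (i : Fin (n - 1)) (f : PolyRing n) :
    dual (demLus t i f) = demLus t⁻¹ i (dual f) := by
  have hφ : ∀ f, dualHom n f = dual f := fun _ => rfl
  rw [← hφ, ← hφ]
  refine map_demLus (dualHom n) (u := C (t ^ ((n : ℤ) - 1))) ?_ ?_ ?_ ?_ ?_ f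
  · rw [Ne, C_eq_zero]
    exact zpow_ne_zero _ t_ne_zero
  · simp [hφ, dual, circ, scale]
  · simp [hφ, dual, circ, scale]
  · simp [hφ, dual, circ, scale, iota_t]
  · intro f
    rw [hφ, hφ, dual_rename]

theorem dual_demLusWord (l : List (Fin (n - 1))) (f : PolyRing n) :
    dual (demLusWord t l f) = demLusWord t⁻¹ l (dual f) := by
  induction l with
  | nil => rfl
  | cons i l ih => rw [demLusWord_cons, demLusWord_cons, dual_demLus, ih]

theorem eval_dual (v : Fin n → BaseField) (f : PolyRing n) :
    eval (fun i => t ^ (1 - (n : ℤ)) * iota (v i)) (dual f) = iota (eval v f) := by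
  have h : (fun i => eval (fun i => t ^ (1 - (n : ℤ)) * iota (v i))
      (C (t ^ ((n : ℤ) - 1)) * X i : PolyRing n)) = fun i => iota (v i) := by
    funext i
    rw [eval_mul, eval_C, eval_X, ← mul_assoc, ← zpow_add₀ t_ne_zero]
    simp
  rw [dual, scale, eval, eval₂Hom_bind₁]
  change eval₂Hom (RingHom.id _) (fun i => eval (fun i => t ^ (1 - (n : ℤ)) * iota (v i))
      (C (t ^ ((n : ℤ) - 1)) * X i : PolyRing n)) (circ f) = _
  rw [h, circ]
  change eval _ (map iota f) = _
  rw [eval_map, eval₂_comp]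
  rfl

end Circ

/-! ### Spectral vectors -/

section Points

variable {n : ℕ}

/-- So k_i(v) counts the positions before i in the total order by decreasing value, with ties read
from left to right. -/
theorem kStat_eq_card (v : Fin n → ℤ) (i : Fin n) :
    kStat v i = (Finset.univ.filter fun k => v i < v k ∨ (v k = v i ∧ k < i)).card := by
  rw [kStat, ← Finset.card_union_of_disjoint]
  · congr 1
    ext k
    simp only [Finset.mem_union, Finset.mem_filter, Finset.mem_univ, true_and]
    rcases lt_trichotomy k i with h | rfl | h
    · simp only [h, true_and, h.not_gt, false_and, or_false, and_true, le_iff_lt_or_eq,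
        eq_comm (a := v i)]
    · simp
    · simp only [h, true_and, h.not_gt, false_and, and_false, or_false, false_or]
  · rw [Finset.disjoint_filter]
    rintro k _ ⟨h1, _⟩ ⟨h2, _⟩
    exact h1.not_gt h2

theorem kStat_hi {v : Fin n → ℤ} {i : Fin (n - 1)} (h : v (lo i) = v (hi i)) :
    kStat v (hi i) = kStat v (lo i) + 1 := by
  have hmem : lo i ∉ Finset.univ.filter fun k => v (lo i) < v k ∨ (v k = v (lo i) ∧ k < lo i) := by
    simp
  rw [kStat_eq_card, kStat_eq_card, ← Finset.card_insert_of_notMem hmem]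
  congr 1
  ext k
  simp only [Finset.mem_insert, Finset.mem_filter, Finset.mem_univ, true_and, ← h]
  have : k < hi i ↔ k = lo i ∨ k < lo i := by
    simp only [lo, hi, Fin.lt_def, Fin.ext_iff]; omega
  rw [this]
  constructor
  · rintro (h | ⟨h, h' | h'⟩)
    · exact Or.inr (Or.inl h)
    · exact Or.inl h'
    · exact Or.inr (Or.inr ⟨h, h'⟩)
  · rintro (h | h | ⟨h, h'⟩)
    · subst h; exact Or.inr ⟨rfl, Or.inl rfl⟩
    · exact Or.inl h
    · exact Or.inr ⟨h, Or.inr h'⟩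

theorem kStat_comp_simple {v : Fin n → ℤ} {i : Fin (n - 1)} (h : v (lo i) ≠ v (hi i))
    (j : Fin n) : kStat (v ∘ simple i) j = kStat v (simple i j) := by
  rw [kStat_eq_card, kStat_eq_card]
  have key : ∀ k j : Fin n, v k = v j → simple i k < simple i j → k < j := by
    intro k j hv hlt
    by_contra hc
    rcases (not_lt.1 hc).eq_or_lt with rfl | hlt'
    · exact lt_irrefl _ hlt
    · by_cases h' : j = lo i ∧ k = hi i
      · rw [h'.1, h'.2] at hv; exact h hv.symm
      · exact lt_asymm hlt (simple_lt_simple hlt' h')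
  refine Finset.card_bij' (fun k _ => simple i k) (fun k _ => simple i k) ?_ ?_ ?_ ?_
  · intro k hk
    simp only [Finset.mem_filter, Finset.mem_univ, true_and, Function.comp_apply] at hk ⊢
    refine hk.imp_right fun hk => ⟨hk.1, ?_⟩
    exact key _ _ hk.1 (by simpa using hk.2)
  · intro k hk
    simp only [Finset.mem_filter, Finset.mem_univ, true_and, Function.comp_apply,
      simple_simple] at hk ⊢
    refine hk.imp_right fun hk => ⟨hk.1, ?_⟩
    by_contra hc
    rcases (not_lt.1 hc).eq_or_lt with he | hlt
    · rw [he, simple_simple] at hk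
      exact lt_irrefl _ hk.2
    · have := key (simple i j) k hk.1.symm (by rwa [simple_simple])
      exact lt_asymm this hk.2
  · intro k _; simp
  · intro k _; simp

/-- Negation with reversal of positions reverses that total order; the positions before and after a
given one number n - 1 together. -/
theorem kStat_neg_rev (v : Fin n → ℤ) (i : Fin n) :
    kStat (fun k => -v k.rev) i + kStat v i.rev = n - 1 := by
  rw [kStat_eq_card, kStat_eq_card]
  have h1 : (Finset.univ.filter fun k : Fin n =>
      -v i.rev < -v k.rev ∨ (-v k.rev = -v i.rev ∧ k < i)).card =
      (Finset.univ.filter fun k : Fin n => v k < v i.rev ∨ (v k = v i.rev ∧ i.rev < k)).card := by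
    refine Finset.card_bij' (fun k _ => k.rev) (fun k _ => k.rev) ?_ ?_ ?_ ?_ <;> intro k hk
    · simpa [Fin.rev_lt_rev] using hk
    · simpa [Fin.rev_lt_iff] using hk
    · simp
    · simp
  rw [h1, ← Finset.card_union_of_disjoint]
  · have h2 : (Finset.univ.filter fun k : Fin n => v k < v i.rev ∨ (v k = v i.rev ∧ i.rev < k)) ∪
        (Finset.univ.filter fun k : Fin n => v i.rev < v k ∨ (v k = v i.rev ∧ k < i.rev)) =
        Finset.univ.erase i.rev := by
      ext k
      simp only [Finset.mem_union, Finset.mem_filter, Finset.mem_univ, true_and,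
        Finset.mem_erase, and_true]
      constructor
      · rintro h rfl
        simp at h
      · intro hk
        rcases lt_trichotomy (v k) (v i.rev) with h | h | h
        · exact Or.inl (Or.inl h)
        · rcases lt_or_gt_of_ne hk with h' | h'
          · exact Or.inr (Or.inr ⟨h, h'⟩)
          · exact Or.inl (Or.inr ⟨h, h'⟩)
        · exact Or.inr (Or.inl h)
    rw [h2, Finset.card_erase_of_mem (Finset.mem_univ _), Finset.card_univ, Fintype.card_fin]
  · rw [Finset.disjoint_filter]
    rintro k _ h1 h2
    rcases h1 with h1 | h1 <;> rcases h2 with h2 | h2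
    · exact lt_asymm h1 h2
    · exact h1.ne h2.1
    · exact h2.ne h1.1.symm
    · exact lt_asymm h1.2 h2.2

/-- The spectral vector of a composition. -/
def point (β : Fin n → ℕ) : Fin n → BaseField := bar fun i => (β i : ℤ)

/-- The statistic `kStat` of a composition. -/
def kComp (β : Fin n → ℕ) : Fin n → ℕ := kStat fun i => (β i : ℤ)

theorem kComp_eq_card (β : Fin n → ℕ) (i : Fin n) :
    kComp β i = (Finset.univ.filter fun k => β i < β k ∨ (β k = β i ∧ k < i)).card := by
  rw [kComp, kStat_eq_card]
  simp only [Nat.cast_lt, Nat.cast_inj]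

theorem point_apply (β : Fin n → ℕ) (i : Fin n) :
    point β i = q ^ (β i : ℤ) * t ^ (-(kComp β i : ℤ)) := rfl

theorem point_ne_zero (β : Fin n → ℕ) (i : Fin n) : point β i ≠ 0 :=
  mul_ne_zero (zpow_ne_zero _ q_ne_zero) (zpow_ne_zero _ t_ne_zero)

theorem point_lo_of_eq {β : Fin n → ℕ} {i : Fin (n - 1)} (h : β (lo i) = β (hi i)) :
    point β (lo i) = t * point β (hi i) := by
  rw [point_apply, point_apply, h, kComp, kStat_hi (by simp [h]), mul_left_comm,
    ← zpow_one_add₀ t_ne_zero]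
  congr 2
  push_cast
  ring

/-- Equal exponents of q mean equal entries, and then the exponents of t differ by one. -/
theorem point_lo_ne_point_hi (β : Fin n → ℕ) (i : Fin (n - 1)) :
    point β (lo i) - point β (hi i) ≠ 0 := by
  rw [sub_ne_zero]
  intro h
  rw [point_apply, point_apply] at h
  obtain ⟨h1, h2⟩ := q_zpow_mul_t_zpow_injective h
  have h3 := kStat_hi (v := fun i => (β i : ℤ)) h1
  rw [kComp, h3] at h2
  push_cast at h2
  omega

theorem point_comp_simple {β : Fin n → ℕ} {i : Fin (n - 1)} (h : β (lo i) ≠ β (hi i)) :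
    point (β ∘ simple i) = point β ∘ simple i := by
  funext j
  have hk : kComp (β ∘ simple i) j = kComp β (simple i j) :=
    kStat_comp_simple (v := fun i => (β i : ℤ)) (by simpa using h) j
  rw [Function.comp_apply, point_apply, point_apply, hk]
  rfl

theorem tilde_eq (β : Fin n → ℕ) :
    tilde (fun i => (β i : ℤ)) = fun i => t ^ (1 - (n : ℤ)) * iota (point β (longest n i)) := by
  funext i
  have h := kStat_neg_rev (fun i => (β i : ℤ)) i
  have hn : 1 ≤ n := Nat.one_le_of_lt i.2
  rw [longest_apply, point_apply, map_mul, map_zpow₀, map_zpow₀, iota_q, iota_t, tilde, bar,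
    inv_zpow', inv_zpow', mul_left_comm, ← zpow_add₀ t_ne_zero]
  congr 2
  rw [kComp]
  omega

theorem size_cons (a : ℕ) (β : Fin n → ℕ) :
    size (Fin.cons a β : Fin (n + 1) → ℕ) = a + size β := by
  simp [size, Fin.sum_univ_succ]

theorem size_snoc (a : ℕ) (β : Fin n → ℕ) :
    size (Fin.snoc β a : Fin (n + 1) → ℕ) = size β + a := by
  simp [size, Fin.sum_univ_castSucc]

theorem kComp_cons_zero (a : ℕ) (β : Fin n → ℕ) :
    kComp (Fin.cons a β : Fin (n + 1) → ℕ) 0 = (Finset.univ.filter fun k => a < β k).card := by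
  rw [kComp_eq_card, Finset.card_filter, Finset.card_filter, Fin.sum_univ_succ]
  simp

theorem kComp_cons_succ (a : ℕ) (β : Fin n → ℕ) (i : Fin n) :
    kComp (Fin.cons a β : Fin (n + 1) → ℕ) i.succ = (if β i ≤ a then 1 else 0) + kComp β i := by
  rw [kComp_eq_card, kComp_eq_card, Finset.card_filter, Finset.card_filter, Fin.sum_univ_succ]
  simp [le_iff_lt_or_eq, eq_comm]

theorem kComp_snoc_last (a : ℕ) (β : Fin n → ℕ) :
    kComp (Fin.snoc β a : Fin (n + 1) → ℕ) (Fin.last n) =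
      (Finset.univ.filter fun k => a ≤ β k).card := by
  rw [kComp_eq_card, Finset.card_filter, Finset.card_filter, Fin.sum_univ_castSucc]
  simp [le_iff_lt_or_eq, eq_comm, Fin.castSucc_lt_last]

theorem kComp_snoc_castSucc (a : ℕ) (β : Fin n → ℕ) (i : Fin n) :
    kComp (Fin.snoc β a : Fin (n + 1) → ℕ) i.castSucc =
      kComp β i + (if β i < a then 1 else 0) := by
  rw [kComp_eq_card, kComp_eq_card, Finset.card_filter, Finset.card_filter,
    Fin.sum_univ_castSucc]
  simp [(Fin.castSucc_lt_last _).not_gt]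

/-- The affine move (a, β) ↦ (β, a+1) preserves ranks, because a + 1 ≤ β_k means a < β_k. On
spectral vectors it is therefore a cyclic shift with one factor q. -/
theorem point_snoc_succ_last (a : ℕ) (β : Fin n → ℕ) :
    point (Fin.snoc β (a + 1) : Fin (n + 1) → ℕ) (Fin.last n) =
      q * point (Fin.cons a β : Fin (n + 1) → ℕ) 0 := by
  rw [point_apply, point_apply, kComp_snoc_last, kComp_cons_zero, ← mul_assoc,
    ← zpow_one_add₀ q_ne_zero]
  simp [add_comm]

theorem point_snoc_succ_castSucc (a : ℕ) (β : Fin n → ℕ) (i : Fin n) :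
    point (Fin.snoc β (a + 1) : Fin (n + 1) → ℕ) i.castSucc =
      point (Fin.cons a β : Fin (n + 1) → ℕ) i.succ := by
  rw [point_apply, point_apply, kComp_snoc_castSucc, kComp_cons_succ]
  simp [add_comm]

theorem point_snoc_zero_last (β : Fin n → ℕ) :
    point (Fin.snoc β 0 : Fin (n + 1) → ℕ) (Fin.last n) = t ^ (-(n : ℤ)) := by
  rw [point_apply, kComp_snoc_last]
  simp

theorem point_snoc_zero_castSucc (β : Fin n → ℕ) (i : Fin n) :
    point (Fin.snoc β 0 : Fin (n + 1) → ℕ) i.castSucc = point β i := by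
  rw [point_apply, point_apply, kComp_snoc_castSucc]
  simp

theorem point_snoc_succ_last_ne (a : ℕ) (β : Fin n → ℕ) :
    point (Fin.snoc β (a + 1) : Fin (n + 1) → ℕ) (Fin.last n) - t ^ (-(n : ℤ)) ≠ 0 := by
  rw [sub_ne_zero, point_apply]
  intro h
  rw [← one_mul (t ^ (-(n : ℤ))), ← zpow_zero q] at h
  have := (q_zpow_mul_t_zpow_injective h).1
  simp at this
  omega

end Points

section Support

variable {n m : ℕ}

/-! ### Polynomials with restricted support -/

/-- The polynomials all of whose exponents satisfy `P`. -/
def supp (P : (Fin n → ℕ) → Prop) : Submodule BaseField (PolyRing n) :=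
  restrictSupport BaseField {γ | P γ}

theorem mem_supp {P : (Fin n → ℕ) → Prop} {f : PolyRing n} :
    f ∈ supp P ↔ ∀ γ : Fin n →₀ ℕ, coeff γ f ≠ 0 → P γ := by
  rw [supp, mem_restrictSupport_iff]
  simp only [Set.subset_def, Finset.mem_coe, mem_support_iff, Set.mem_ofPred_eq]

/-- The monomial `x^β`. -/
def mon (β : Fin n → ℕ) : PolyRing n := monomial (Finsupp.equivFunOnFinite.symm β) 1

theorem mon_eq_prod (β : Fin n → ℕ) : mon β = ∏ i, (X i : PolyRing n) ^ β i := by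
  rw [mon, monomial_eq, C_1, one_mul, Finsupp.prod_fintype _ _ (by simp)]
  rfl

theorem mon_mem_supp {P : (Fin n → ℕ) → Prop} {β : Fin n → ℕ} (h : P β) : mon β ∈ supp P := by
  rw [supp, mon, monomial_mem_restrictSupport]
  exact Or.inl h

theorem supp_mono {P P' : (Fin n → ℕ) → Prop} (h : ∀ γ, P γ → P' γ) {f : PolyRing n}
    (hf : f ∈ supp P) : f ∈ supp P' :=
  restrictSupport_mono _ (fun γ => h γ) hf

theorem C_mul_mem_supp {P : (Fin n → ℕ) → Prop} (c : BaseField) {f : PolyRing n}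
    (hf : f ∈ supp P) : C c * f ∈ supp P := by
  rw [← smul_eq_C_mul]
  exact Submodule.smul_mem _ c hf

theorem map_mem_supp (L : PolyRing n →ₗ[BaseField] PolyRing m) {P : (Fin n → ℕ) → Prop}
    {P' : (Fin m → ℕ) → Prop} (h : ∀ γ, P γ → L (mon γ) ∈ supp P') {f : PolyRing n}
    (hf : f ∈ supp P) : L f ∈ supp P' := by
  rw [mem_supp] at hf
  rw [f.as_sum, map_sum]
  refine Submodule.sum_mem _ fun γ hγ => ?_
  have e : monomial γ (coeff γ f) = coeff γ f • mon (⇑γ) := by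
    rw [mon, smul_monomial, smul_eq_mul, mul_one]
    rw [show Finsupp.equivFunOnFinite.symm ⇑γ = γ from Finsupp.ext fun _ => rfl]
  rw [e, map_smul]
  exact Submodule.smul_mem _ _ (h γ (hf γ (mem_support_iff.1 hγ)))

theorem sub_coeff_mul_mon_mem_supp {P : (Fin n → ℕ) → Prop} {f : PolyRing n} (hf : f ∈ supp P)
    (α : Fin n → ℕ) :
    f - C (coeff (Finsupp.equivFunOnFinite.symm α) f) * mon α ∈ supp fun γ => P γ ∧ γ ≠ α := by
  rw [mem_supp] at hf ⊢
  intro γ hγ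
  rw [coeff_sub, coeff_C_mul, mon, coeff_monomial] at hγ
  by_cases h : Finsupp.equivFunOnFinite.symm α = γ
  · simp [h] at hγ
  · rw [if_neg h, mul_zero, sub_zero] at hγ
    refine ⟨hf γ hγ, fun h' => h ?_⟩
    ext i
    exact (congrFun h' i).symm

theorem coeff_eq_zero_of_mem_supp {P : (Fin n → ℕ) → Prop} {f : PolyRing n} (hf : f ∈ supp P)
    {α : Fin n → ℕ} (hα : ¬ P α) : coeff (Finsupp.equivFunOnFinite.symm α) f = 0 := by
  by_contra h
  exact hα (mem_supp.1 hf _ h)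

theorem size_eq_degree (γ : Fin n →₀ ℕ) : size γ = γ.degree :=
  (Finsupp.degree_eq_sum γ).symm

/-- The polynomials of degree less than `d`. -/
abbrev low (n d : ℕ) : Submodule BaseField (PolyRing n) := supp fun γ => size γ < d

/-- The homogeneous polynomials of degree `d`. -/
abbrev hom (n d : ℕ) : Submodule BaseField (PolyRing n) := supp fun γ => size γ = d

theorem mem_low_succ {d : ℕ} {f : PolyRing n} : f ∈ low n (d + 1) ↔ f.totalDegree ≤ d := by
  rw [mem_supp, totalDegree, Finset.sup_le_iff]
  simp only [Nat.lt_succ_iff, mem_support_iff, size]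
  refine forall₂_congr fun γ _ => ?_
  rw [Finsupp.sum_fintype _ _ fun _ => rfl]

theorem eq_zero_of_mem_low_zero {f : PolyRing n} (hf : f ∈ low n 0) : f = 0 := by
  ext γ
  by_contra h
  exact absurd (mem_supp.1 hf γ h) (Nat.not_lt_zero _)

theorem eq_zero_of_mem_low_of_mem_hom {d : ℕ} {f : PolyRing n} (h1 : f ∈ low n d)
    (h2 : f ∈ hom n d) : f = 0 := by
  ext γ
  by_contra h
  have := mem_supp.1 h1 γ h
  rw [mem_supp.1 h2 γ h] at this
  exact lt_irrefl _ this

theorem homogeneousComponent_eq_zero_of_mem_low {d : ℕ} {f : PolyRing n} (h : f ∈ low n d) :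
    homogeneousComponent d f = 0 := by
  apply homogeneousComponent_eq_zero'
  intro γ hγ
  rw [← size_eq_degree]
  exact (mem_supp.1 h γ (mem_support_iff.1 hγ)).ne

theorem mem_low_of_homogeneousComponent_eq_zero {d : ℕ} {f : PolyRing n}
    (h : f ∈ low n (d + 1)) (h0 : homogeneousComponent d f = 0) : f ∈ low n d := by
  rw [mem_supp] at h ⊢
  intro γ hγ
  refine lt_of_le_of_ne (Nat.lt_succ_iff.1 (h γ hγ)) fun hd => hγ ?_
  have := coeff_homogeneousComponent d γ (φ := f)
  rwa [h0, coeff_zero, ← size_eq_degree, if_pos hd, eq_comm] at this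

theorem mul_mem_low {f g : PolyRing n} {d : ℕ} (hf : f.totalDegree ≤ 1) (hg : g ∈ low n d) :
    f * g ∈ low n (d + 1) := by
  rcases d with _ | d
  · rw [eq_zero_of_mem_low_zero hg, mul_zero]
    exact Submodule.zero_mem _
  · rw [mem_low_succ] at hg ⊢
    exact (totalDegree_mul f g).trans (by omega)

theorem bind₁_mem_low {φ : Fin n → PolyRing m} (h : ∀ i, (φ i).totalDegree ≤ 1) {d : ℕ}
    {f : PolyRing n} (hf : f ∈ low n d) : bind₁ φ f ∈ low m d := by
  refine map_mem_supp (bind₁ φ).toLinearMap (fun γ hγ => ?_) hf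
  rcases d with _ | d
  · exact absurd hγ (Nat.not_lt_zero _)
  rw [mem_low_succ, AlgHom.toLinearMap_apply, mon_eq_prod, map_prod]
  refine (totalDegree_finsetProd _ _).trans (le_trans ?_ (Nat.lt_succ_iff.1 hγ))
  refine Finset.sum_le_sum fun i _ => ?_
  rw [map_pow, bind₁_X_right]
  exact (totalDegree_pow _ _).trans ((Nat.mul_le_mul_left _ (h i)).trans_eq (mul_one _))


/-! ### Demazure–Lusztig operators on monomials -/

/-- `γ'` lies in the segment of compositions between `γ` and `s_i γ`. -/
def InString (i : Fin (n - 1)) (γ γ' : Fin n → ℕ) : Prop :=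
  (∀ u, u ≠ lo i → u ≠ hi i → γ' u = γ u) ∧ γ' (lo i) + γ' (hi i) = γ (lo i) + γ (hi i) ∧
    min (γ (lo i)) (γ (hi i)) ≤ γ' (lo i) ∧ min (γ (lo i)) (γ (hi i)) ≤ γ' (hi i)

theorem demLus_X_hi_pow (s : BaseField) (i : Fin (n - 1)) (k : ℕ) :
    demLus s i (X (hi i) ^ k) = C s * X (lo i) ^ k +
      C (1 - s) * ∑ l ∈ Finset.range k, X (lo i) ^ (l + 1) * X (hi i) ^ (k - 1 - l) := by
  apply demLus_eq_of_mul_eq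
  have h := (Commute.all (X (lo i) : PolyRing n) (X (hi i))).geom_sum₂_mul k
  have h2 : ∑ l ∈ Finset.range k, (X (lo i) ^ (l + 1) * X (hi i) ^ (k - 1 - l) : PolyRing n) =
      X (lo i) * ∑ l ∈ Finset.range k, X (lo i) ^ l * X (hi i) ^ (k - 1 - l) := by
    rw [Finset.mul_sum]
    exact Finset.sum_congr rfl fun l _ => by ring
  rw [h2, map_pow, rename_X, simple_hi]
  simp only [map_sub, map_one]
  linear_combination (1 - C s) * X (lo i) * h

theorem demLus_X_lo_pow (s : BaseField) (i : Fin (n - 1)) (k : ℕ) :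
    demLus s i (X (lo i) ^ k) = C s * X (hi i) ^ k -
      C (1 - s) * ∑ l ∈ Finset.range k, X (lo i) ^ (l + 1) * X (hi i) ^ (k - 1 - l) := by
  apply demLus_eq_of_mul_eq
  have h := (Commute.all (X (lo i) : PolyRing n) (X (hi i))).geom_sum₂_mul k
  have h2 : ∑ l ∈ Finset.range k, (X (lo i) ^ (l + 1) * X (hi i) ^ (k - 1 - l) : PolyRing n) =
      X (lo i) * ∑ l ∈ Finset.range k, X (lo i) ^ l * X (hi i) ^ (k - 1 - l) := by
    rw [Finset.mul_sum]
    exact Finset.sum_congr rfl fun l _ => by ring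
  rw [h2, map_pow, rename_X, simple_lo]
  simp only [map_sub, map_one]
  linear_combination -(1 - C s) * X (lo i) * h

/-- The composition that agrees with `γ` except for the values `a`, `b` at `i`, `i + 1`. -/
def setPair (i : Fin (n - 1)) (γ : Fin n → ℕ) (a b : ℕ) : Fin n → ℕ :=
  Function.update (Function.update γ (lo i) a) (hi i) b

@[simp] theorem setPair_lo (i : Fin (n - 1)) (γ : Fin n → ℕ) (a b : ℕ) :
    setPair i γ a b (lo i) = a := by
  simp [setPair, lo_ne_hi]

@[simp] theorem setPair_hi (i : Fin (n - 1)) (γ : Fin n → ℕ) (a b : ℕ) :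
    setPair i γ a b (hi i) = b := by
  simp [setPair]

theorem setPair_of_ne (i : Fin (n - 1)) (γ : Fin n → ℕ) (a b : ℕ) {u : Fin n} (h1 : u ≠ lo i)
    (h2 : u ≠ hi i) : setPair i γ a b u = γ u := by
  simp [setPair, h1, h2]

theorem ext_pair {i : Fin (n - 1)} {γ γ' : Fin n → ℕ} (h : ∀ u, u ≠ lo i → u ≠ hi i → γ u = γ' u)
    (h1 : γ (lo i) = γ' (lo i)) (h2 : γ (hi i) = γ' (hi i)) : γ = γ' := by
  funext u
  by_cases h3 : u = lo i
  · rw [h3, h1]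
  by_cases h4 : u = hi i
  · rw [h4, h2]
  exact h u h3 h4

theorem mon_add (γ δ : Fin n → ℕ) : mon (γ + δ) = mon γ * mon δ := by
  simp only [mon_eq_prod, Pi.add_apply, pow_add, Finset.prod_mul_distrib]

theorem mon_single (u : Fin n) (k : ℕ) : mon (Pi.single u k) = X u ^ k := by
  rw [mon_eq_prod, Finset.prod_eq_single u]
  · simp
  · intro v _ hv; simp [hv]
  · simp

theorem mon_setPair (i : Fin (n - 1)) (γ : Fin n → ℕ) (c a b : ℕ) :
    mon (setPair i γ (c + a) (c + b)) = mon (setPair i γ c c) * (X (lo i) ^ a * X (hi i) ^ b) := by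
  rw [← mon_single, ← mon_single, ← mon_add, ← mon_add]
  congr 1
  refine ext_pair (i := i) (fun u h1 h2 => ?_) ?_ ?_
  · simp [setPair_of_ne, h1, h2]
  · simp [lo_ne_hi]
  · simp [(lo_ne_hi i).symm]

theorem rename_mon (w : Equiv.Perm (Fin n)) (γ : Fin n → ℕ) : rename w (mon (γ ∘ w)) = mon γ := by
  rw [mon_eq_prod, mon_eq_prod, map_prod, ← Equiv.prod_comp w fun i => X i ^ γ i]
  simp

theorem rename_mon_setPair_self (i : Fin (n - 1)) (γ : Fin n → ℕ) (c : ℕ) :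
    rename (simple i) (mon (setPair i γ c c)) = mon (setPair i γ c c) := by
  conv_lhs => rw [← comp_simple_eq_self (α := setPair i γ c c) (i := i) (by simp)]
  rw [rename_mon]

theorem demLus_mon_of_le (s : BaseField) {i : Fin (n - 1)} {γ : Fin n → ℕ} {c k : ℕ}
    (h1 : γ (lo i) = c) (h2 : γ (hi i) = c + k) :
    demLus s i (mon γ) = C s * mon (setPair i γ (c + k) c) + C (1 - s) *
      ∑ l ∈ Finset.range k, mon (setPair i γ (c + (l + 1)) (c + (k - 1 - l))) := by
  have e : γ = setPair i γ (c + 0) (c + k) :=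
    ext_pair (i := i) (fun u h1 h2 => (setPair_of_ne _ _ _ _ h1 h2).symm) (by simp [h1])
      (by simp [h2])
  conv_lhs => rw [e, mon_setPair, pow_zero, one_mul,
    demLus_mul_of_symm _ (rename_mon_setPair_self i γ c), demLus_X_hi_pow]
  have e2 := mon_setPair i γ c k 0
  rw [add_zero, pow_zero, mul_one] at e2
  simp only [mon_setPair, e2, ← Finset.mul_sum]
  ring

theorem demLus_mon_of_ge (s : BaseField) {i : Fin (n - 1)} {γ : Fin n → ℕ} {c k : ℕ}
    (h1 : γ (lo i) = c + k) (h2 : γ (hi i) = c) :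
    demLus s i (mon γ) = C s * mon (setPair i γ c (c + k)) - C (1 - s) *
      ∑ l ∈ Finset.range k, mon (setPair i γ (c + (l + 1)) (c + (k - 1 - l))) := by
  have e : γ = setPair i γ (c + k) (c + 0) :=
    ext_pair (i := i) (fun u h1 h2 => (setPair_of_ne _ _ _ _ h1 h2).symm) (by simp [h1])
      (by simp [h2])
  conv_lhs => rw [e, mon_setPair, pow_zero, mul_one,
    demLus_mul_of_symm _ (rename_mon_setPair_self i γ c), demLus_X_lo_pow]
  have e2 := mon_setPair i γ c 0 k
  rw [add_zero, pow_zero, one_mul] at e2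
  simp only [mon_setPair, e2, ← Finset.mul_sum]
  ring

theorem demLus_mon_mem (s : BaseField) (i : Fin (n - 1)) (γ : Fin n → ℕ) :
    demLus s i (mon γ) ∈ supp (InString i γ) := by
  have key : ∀ a b : ℕ, a + b = γ (lo i) + γ (hi i) → min (γ (lo i)) (γ (hi i)) ≤ a →
      min (γ (lo i)) (γ (hi i)) ≤ b → mon (setPair i γ a b) ∈ supp (InString i γ) := by
    intro a b h1 h2 h3
    refine mon_mem_supp ⟨fun u h h' => setPair_of_ne _ _ _ _ h h', ?_, ?_, ?_⟩ <;>
      first | rwa [setPair_lo, setPair_hi] | rwa [setPair_lo] | rwa [setPair_hi]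
  rcases le_total (γ (lo i)) (γ (hi i)) with h | h
  · obtain ⟨k, hk⟩ := Nat.exists_eq_add_of_le h
    rw [demLus_mon_of_le s rfl hk]
    refine Submodule.add_mem _ (C_mul_mem_supp _ (key _ _ ?_ ?_ ?_))
      (C_mul_mem_supp _ (Submodule.sum_mem _ fun l hl => key _ _ ?_ ?_ ?_)) <;>
    first | omega | (rw [Finset.mem_range] at hl; omega)
  · obtain ⟨k, hk⟩ := Nat.exists_eq_add_of_le h
    rw [demLus_mon_of_ge s hk rfl]
    refine Submodule.sub_mem _ (C_mul_mem_supp _ (key _ _ ?_ ?_ ?_))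
      (C_mul_mem_supp _ (Submodule.sum_mem _ fun l hl => key _ _ ?_ ?_ ?_)) <;>
    first | omega | (rw [Finset.mem_range] at hl; omega)

theorem coeff_demLus_mon (s : BaseField) {i : Fin (n - 1)} {γ : Fin n → ℕ}
    (h : γ (lo i) < γ (hi i)) :
    coeff (Finsupp.equivFunOnFinite.symm (γ ∘ simple i)) (demLus s i (mon γ)) = 1 := by
  obtain ⟨k, hk⟩ := Nat.exists_eq_add_of_lt h
  rw [demLus_mon_of_le s rfl (k := k + 1) hk, coeff_add, coeff_C_mul, coeff_C_mul, coeff_sum]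
  have e : γ ∘ simple i = setPair i γ (γ (lo i) + (k + 1)) (γ (lo i)) := by
    refine ext_pair (i := i) (fun u h1 h2 => ?_) ?_ ?_
    · rw [setPair_of_ne _ _ _ _ h1 h2, Function.comp_apply, simple_of_ne h1 h2]
    · simp [hk, add_assoc]
    · simp
  -- The monomial occurs twice, with coefficient s from s_i and 1 - s from the last term of the
  -- geometric sum; together they give 1.
  rw [e, Finset.sum_eq_single k]
  · simp [mon]
  · intro l _ hl
    rw [mon, coeff_monomial, if_neg]
    intro he
    have := congrFun (Finsupp.equivFunOnFinite.symm.injective he) (lo i)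
    rw [setPair_lo, setPair_lo] at this
    omega
  · simp

theorem size_of_inString {i : Fin (n - 1)} {γ γ' : Fin n → ℕ} (h : InString i γ γ') :
    size γ' = size γ := by
  have hmem : hi i ∈ Finset.univ.erase (lo i) :=
    Finset.mem_erase.2 ⟨(lo_ne_hi i).symm, Finset.mem_univ _⟩
  rw [size, size, ← Finset.add_sum_erase _ _ (Finset.mem_univ (lo i)),
    ← Finset.add_sum_erase _ _ hmem, ← Finset.add_sum_erase _ γ (Finset.mem_univ (lo i)),
    ← Finset.add_sum_erase _ γ hmem, ← add_assoc, ← add_assoc, h.2.1]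
  congr 1
  refine Finset.sum_congr rfl fun u hu => ?_
  simp only [Finset.mem_erase, Finset.mem_univ, and_true] at hu
  exact h.1 u hu.2 hu.1

theorem demLus_mem_supp_size (s : BaseField) (i : Fin (n - 1)) (P : ℕ → Prop) {f : PolyRing n}
    (hf : f ∈ supp fun γ => P (size γ)) : demLus s i f ∈ supp fun γ => P (size γ) :=
  map_mem_supp (demLus s i) (fun γ hγ => supp_mono
    (fun γ' h => by rw [size_of_inString h]; exact hγ) (demLus_mon_mem s i γ)) hf

theorem demLusWord_mem_supp_size (s : BaseField) (l : List (Fin (n - 1))) (P : ℕ → Prop)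
    {f : PolyRing n} (hf : f ∈ supp fun γ => P (size γ)) :
    demLusWord s l f ∈ supp fun γ => P (size γ) := by
  induction l with
  | nil => exact hf
  | cons i l ih =>
    rw [demLusWord_cons]
    exact demLus_mem_supp_size s i P ih

theorem rename_mem_supp_size (w : Equiv.Perm (Fin n)) (P : ℕ → Prop) {f : PolyRing n}
    (hf : f ∈ supp fun γ => P (size γ)) : rename w f ∈ supp fun γ => P (size γ) := by
  refine map_mem_supp (rename w).toLinearMap (fun γ hγ => ?_) hf
  have := rename_mon w (γ ∘ w.symm)
  rw [Function.comp_assoc, Equiv.symm_comp_self, Function.comp_id] at this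
  rw [AlgHom.toLinearMap_apply, this]
  exact mon_mem_supp (by rw [size_comp]; exact hγ)

theorem circ_mem_supp {P : (Fin n → ℕ) → Prop} {f : PolyRing n} (hf : f ∈ supp P) :
    circ f ∈ supp P := by
  rw [mem_supp] at hf ⊢
  intro γ hγ
  rw [circ, coeff_map] at hγ
  exact hf γ fun h => hγ (by rw [h, map_zero])

theorem scale_mon (c : BaseField) (γ : Fin n → ℕ) : scale c (mon γ) = C (c ^ size γ) * mon γ := by
  simp only [scale, mon_eq_prod, map_prod, map_pow, bind₁_X_right, mul_pow,
    Finset.prod_mul_distrib, Finset.prod_pow_eq_pow_sum, size]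

theorem scale_mem_supp (c : BaseField) {P : (Fin n → ℕ) → Prop} {f : PolyRing n}
    (hf : f ∈ supp P) : scale c f ∈ supp P :=
  map_mem_supp (AlgHom.toLinearMap (bind₁ fun i => C c * X i))
    (fun γ hγ => by
      change scale c (mon γ) ∈ _
      rw [scale_mon]
      exact C_mul_mem_supp _ (mon_mem_supp hγ)) hf

theorem dual_mem_supp {P : (Fin n → ℕ) → Prop} {f : PolyRing n} (hf : f ∈ supp P) :
    dual f ∈ supp P :=
  scale_mem_supp _ (circ_mem_supp hf)

theorem scale_of_mem_hom (c : BaseField) {d : ℕ} {f : PolyRing n} (hf : f ∈ hom n d) :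
    scale c f = C (c ^ d) * f := by
  have h : AlgHom.toLinearMap (bind₁ fun i => C c * X i) f - (c ^ d) • f ∈
      supp fun _ : Fin n → ℕ => False := by
    refine map_mem_supp ((bind₁ fun i => C c * X i).toLinearMap - (c ^ d) • LinearMap.id)
      (fun γ hγ => ?_) hf
    change scale c (mon γ) - (c ^ d) • mon γ ∈ _
    rw [scale_mon, hγ, smul_eq_C_mul, sub_self]
    exact Submodule.zero_mem _
  rw [← sub_eq_zero, ← smul_eq_C_mul]
  ext γ
  by_contra h'
  exact mem_supp.1 h γ h'

end Support

section Order

variable {n : ℕ}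

/-! ### The triangularity order on compositions -/

/-- The number of points `(u, h)` in the diagram of `γ`, with the first `j` rows extended by one
box, that lie beyond height `m`. -/
def ramp (m j : ℕ) (γ : Fin n → ℕ) : ℕ := ∑ u : Fin n, (γ u + (if (u : ℕ) < j then 1 else 0) - m)

/-- The partial order for which the top homogeneous parts of the interpolation polynomials are
triangular. -/
def Below (γ α : Fin n → ℕ) : Prop := size γ = size α ∧ ∀ m j, ramp m j γ ≤ ramp m j α

theorem sum_eq_add_pair (i : Fin (n - 1)) (f : Fin n → ℕ) :
    ∑ u, f u = f (lo i) + f (hi i) + ∑ u ∈ (Finset.univ.erase (lo i)).erase (hi i), f u := by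
  have hmem : hi i ∈ Finset.univ.erase (lo i) :=
    Finset.mem_erase.2 ⟨(lo_ne_hi i).symm, Finset.mem_univ _⟩
  rw [← Finset.add_sum_erase _ _ (Finset.mem_univ (lo i)), ← Finset.add_sum_erase _ _ hmem,
    add_assoc]

/-- The contribution to `ramp` of the rows other than `i` and `i + 1`. -/
def rest (m j : ℕ) (i : Fin (n - 1)) (γ : Fin n → ℕ) : ℕ :=
  ∑ u ∈ (Finset.univ.erase (lo i)).erase (hi i), (γ u + (if (u : ℕ) < j then 1 else 0) - m)

theorem rest_congr (m : ℕ) {j j' : ℕ} {i : Fin (n - 1)} {γ γ' : Fin n → ℕ}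
    (h : ∀ u, u ≠ lo i → u ≠ hi i → γ u = γ' u)
    (hj : ∀ u : Fin n, u ≠ lo i → u ≠ hi i → ((u : ℕ) < j ↔ (u : ℕ) < j')) :
    rest m j i γ = rest m j' i γ' := by
  refine Finset.sum_congr rfl fun u hu => ?_
  simp only [Finset.mem_erase, Finset.mem_univ, and_true] at hu
  rw [h u hu.2 hu.1]
  simp only [hj u hu.2 hu.1]

theorem ramp_of_ne (m : ℕ) {j : ℕ} {i : Fin (n - 1)} (hj : j ≠ i + 1) :
    ∃ e : ℕ, ∀ γ : Fin n → ℕ,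
      ramp m j γ = (γ (lo i) + e - m) + (γ (hi i) + e - m) + rest m j i γ := by
  refine ⟨if (i : ℕ) < j then 1 else 0, fun γ => ?_⟩
  have h1 : ((lo i : Fin n) : ℕ) < j ↔ (i : ℕ) < j := Iff.rfl
  have h2 : ((hi i : Fin n) : ℕ) < j ↔ (i : ℕ) < j := by
    change (i : ℕ) + 1 < j ↔ _
    omega
  rw [ramp, sum_eq_add_pair i, rest]
  simp only [h1, h2]

theorem ramp_mid (m : ℕ) (i : Fin (n - 1)) (γ : Fin n → ℕ) :
    ramp m (i + 1) γ = (γ (lo i) + 1 - m) + (γ (hi i) - m) + rest m (i + 1) i γ := by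
  have h1 : ((lo i : Fin n) : ℕ) < i + 1 := Nat.lt_succ_self _
  have h2 : ¬ ((hi i : Fin n) : ℕ) < i + 1 := lt_irrefl _
  rw [ramp, sum_eq_add_pair i, rest]
  simp only [h1, h2, if_true, if_false, add_zero]

theorem ramp_lo (m : ℕ) (i : Fin (n - 1)) (γ : Fin n → ℕ) :
    ramp m i γ = (γ (lo i) - m) + (γ (hi i) - m) + rest m (i + 1) i γ := by
  have h1 : ¬ ((lo i : Fin n) : ℕ) < i := lt_irrefl _
  have h2 : ¬ ((hi i : Fin n) : ℕ) < i := (Nat.lt_succ_self _).not_gt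
  rw [ramp, sum_eq_add_pair i, rest_congr m (j' := i) (fun _ _ _ => rfl), rest]
  · simp only [h1, h2, if_false, add_zero]
  · intro u hu _
    simp only [lo, ne_eq, Fin.ext_iff] at hu
    omega

theorem ramp_hi (m : ℕ) (i : Fin (n - 1)) (γ : Fin n → ℕ) :
    ramp m (i + 2) γ = (γ (lo i) + 1 - m) + (γ (hi i) + 1 - m) + rest m (i + 1) i γ := by
  have h1 : ((lo i : Fin n) : ℕ) < i + 2 := by change (i : ℕ) < _; omega
  have h2 : ((hi i : Fin n) : ℕ) < i + 2 := by change (i : ℕ) + 1 < _; omega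
  rw [ramp, sum_eq_add_pair i, rest_congr m (j' := i + 2) (fun _ _ _ => rfl), rest]
  · simp only [h1, h2, if_true]
  · intro u _ hu
    simp only [hi, ne_eq, Fin.ext_iff] at hu
    omega

/-- For j other than i + 1 the two rows enter `ramp` symmetrically, and convexity of r ↦ max(r - m,
0) bounds the string by its ends. For j = i + 1 the value at s_i α is that of α at i + 2 if α_i < m,
and one more than that of α at i otherwise; both bounds pass to γ'. -/
theorem below_comp_simple {i : Fin (n - 1)} {α γ γ' : Fin n → ℕ} (h : α (lo i) < α (hi i))
    (hγ : Below γ α) (hs : InString i γ γ') : Below γ' (α ∘ simple i) := by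
  refine ⟨by rw [size_of_inString hs, hγ.1, size_comp], fun m j => ?_⟩
  obtain ⟨hs1, hs2, hs3, hs4⟩ := hs
  have hα : ∀ j, rest m j i (α ∘ simple i) = rest m j i α := fun j =>
    rest_congr m (fun u h1 h2 => by rw [Function.comp_apply, simple_of_ne h1 h2])
      fun _ _ _ => Iff.rfl
  have hr : ∀ j, rest m j i γ' = rest m j i γ := fun j => rest_congr m hs1 fun _ _ _ => Iff.rfl
  by_cases hj : j = i + 1
  · subst hj
    have h1 := hγ.2 m i
    have h2 := hγ.2 m (i + 2)
    rw [ramp_lo, ramp_lo] at h1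
    rw [ramp_hi, ramp_hi] at h2
    rw [ramp_mid, ramp_mid, hα, hr, Function.comp_apply, Function.comp_apply, simple_lo, simple_hi]
    omega
  · obtain ⟨e, he⟩ := ramp_of_ne m hj
    have h1 := hγ.2 m j
    rw [he, he] at h1
    rw [he, he, hα, hr, Function.comp_apply, Function.comp_apply, simple_lo, simple_hi]
    omega

/-- At height m = α_{i+1} the bound for j = i gives γ_i, γ_{i+1} ≤ α_{i+1}, so γ is α or s_i α; the
bound for j = i + 1 gives γ_i < α_{i+1} and excludes s_i α. -/
theorem eq_of_below_of_inString {i : Fin (n - 1)} {α γ : Fin n → ℕ} (h : α (lo i) < α (hi i))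
    (hγ : Below γ α) (hs : InString i γ (α ∘ simple i)) : γ = α := by
  obtain ⟨hs1, hs2, hs3, hs4⟩ := hs
  rw [Function.comp_apply, Function.comp_apply, simple_lo, simple_hi] at hs2
  rw [Function.comp_apply, simple_lo] at hs3
  rw [Function.comp_apply, simple_hi] at hs4
  have hs1' : ∀ u, u ≠ lo i → u ≠ hi i → γ u = α u := fun u h1 h2 => by
    rw [← hs1 u h1 h2, Function.comp_apply, simple_of_ne h1 h2]
  have h1 := hγ.2 (α (hi i)) i
  have h2 := hγ.2 (α (hi i)) (i + 1)
  have hr : rest (α (hi i)) (i + 1) i γ = rest (α (hi i)) (i + 1) i α :=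
    rest_congr _ hs1' fun _ _ _ => Iff.rfl
  rw [ramp_lo, ramp_lo, hr] at h1
  rw [ramp_mid, ramp_mid, hr] at h2
  exact ext_pair hs1' (by omega) (by omega)

theorem not_below_comp_simple {i : Fin (n - 1)} {α : Fin n → ℕ} (h : α (lo i) < α (hi i)) :
    ¬ Below (α ∘ simple i) α := by
  intro hb
  have := eq_of_below_of_inString h hb ⟨fun _ _ _ => rfl, rfl, min_le_left _ _, min_le_right _ _⟩
  have := congrFun this (lo i)
  rw [Function.comp_apply, simple_lo] at this
  omega

/-- The box added to the moved row a is the one that `ramp` adds to row a when it stands first. For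
j > n every row is extended, which lowers the height by one instead. -/
theorem ramp_snoc_succ_of_le (m : ℕ) {j : ℕ} (hj : j ≤ n) (a : ℕ) (β : Fin n → ℕ) :
    ramp m j (Fin.snoc β (a + 1) : Fin (n + 1) → ℕ) =
      ramp m (j + 1) (Fin.cons a β : Fin (n + 1) → ℕ) := by
  rw [ramp, ramp, Fin.sum_univ_castSucc, Fin.sum_univ_succ]
  simp [hj.not_gt, add_comm]

theorem ramp_snoc_succ_of_lt (m : ℕ) {j : ℕ} (hj : n < j) (a : ℕ) (β : Fin n → ℕ) :
    ramp (m + 1) j (Fin.snoc β (a + 1) : Fin (n + 1) → ℕ) =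
      ramp m 1 (Fin.cons a β : Fin (n + 1) → ℕ) := by
  rw [ramp, ramp, Fin.sum_univ_castSucc, Fin.sum_univ_succ]
  have : ∀ u : Fin n, (u : ℕ) < j := fun u => u.2.trans hj
  simp only [Fin.snoc_castSucc, Fin.val_castSucc, this, if_true, Fin.snoc_last, Fin.val_last, hj,
    Fin.cons_zero, Fin.cons_succ, Fin.val_zero, Fin.val_succ]
  simp only [zero_lt_one, if_true, Nat.lt_one_iff, Nat.succ_ne_zero, if_false,
    add_zero, Nat.add_sub_add_right]
  exact add_comm _ _

theorem ramp_zero (j : ℕ) (γ : Fin n → ℕ) :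
    ramp 0 j γ = size γ + ∑ u : Fin n, (if (u : ℕ) < j then 1 else 0) := by
  rw [ramp, size, ← Finset.sum_add_distrib]
  rfl

theorem below_snoc_succ {a c : ℕ} {β γ : Fin n → ℕ}
    (h : Below (Fin.cons c γ : Fin (n + 1) → ℕ) (Fin.cons a β)) :
    Below (Fin.snoc γ (c + 1) : Fin (n + 1) → ℕ) (Fin.snoc β (a + 1)) := by
  have hs : size (Fin.snoc γ (c + 1) : Fin (n + 1) → ℕ) = size (Fin.snoc β (a + 1)) := by
    have := h.1
    rw [size_cons, size_cons] at this
    rw [size_snoc, size_snoc]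
    omega
  refine ⟨hs, fun m j => ?_⟩
  rcases le_or_gt j n with hj | hj
  · rw [ramp_snoc_succ_of_le m hj, ramp_snoc_succ_of_le m hj]
    exact h.2 m (j + 1)
  · rcases m with _ | m
    · rw [ramp_zero, ramp_zero, hs]
    · rw [ramp_snoc_succ_of_lt m hj, ramp_snoc_succ_of_lt m hj]
      exact h.2 m 1

/-- Among the exponents below α only α itself has s_i α in its string, and x^α contributes with
coefficient 1. -/
theorem coeff_demLus_of_triangular (s : BaseField) {i : Fin (n - 1)} {α : Fin n → ℕ}
    (h : α (lo i) < α (hi i)) {E : PolyRing n} (hE : E ∈ supp fun γ => Below γ α) :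
    coeff (Finsupp.equivFunOnFinite.symm (α ∘ simple i)) (demLus s i E) =
      coeff (Finsupp.equivFunOnFinite.symm α) E := by
  have h1 := sub_coeff_mul_mon_mem_supp hE α
  have h2 : demLus s i (E - C (coeff (Finsupp.equivFunOnFinite.symm α) E) * mon α) ∈
      supp fun γ => γ ≠ α ∘ simple i := by
    refine map_mem_supp (demLus s i) (fun γ hγ => ?_) h1
    refine supp_mono (fun γ' hs => ?_) (demLus_mon_mem s i γ)
    rintro rfl
    exact hγ.2 (eq_of_below_of_inString h hγ.1 hs)
  have h3 := coeff_eq_zero_of_mem_supp h2 (α := α ∘ simple i) (by simp)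
  rwa [map_sub, coeff_sub, ← smul_eq_C_mul, map_smul, coeff_smul, coeff_demLus_mon s h, smul_eq_mul,
    mul_one, sub_eq_zero] at h3

theorem demLus_mem_below (s : BaseField) {i : Fin (n - 1)} {α : Fin n → ℕ}
    (h : α (lo i) < α (hi i)) {E : PolyRing n} (hE : E ∈ supp fun γ => Below γ α) :
    demLus s i E ∈ supp fun γ => Below γ (α ∘ simple i) :=
  map_mem_supp (demLus s i) (fun γ hγ => supp_mono
    (fun _ hs => below_comp_simple h hγ hs) (demLus_mon_mem s i γ)) hE

theorem mem_below_comp_simple {i : Fin (n - 1)} {α : Fin n → ℕ}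
    (h : α (lo i) < α (hi i)) {E : PolyRing n} (hE : E ∈ supp fun γ => Below γ α) :
    E ∈ supp fun γ => Below γ (α ∘ simple i) :=
  supp_mono (fun _ hγ => below_comp_simple h hγ
    ⟨fun _ _ _ => rfl, rfl, min_le_left _ _, min_le_right _ _⟩) hE

end Order

/-! ### The affine shift -/

section Shift

variable {n : ℕ}

/-- The operator `f ↦ f(x_n / q, x_1, …, x_(n-1))`. -/
def shift (n : ℕ) : PolyRing (n + 1) →ₐ[BaseField] PolyRing (n + 1) :=
  bind₁ (Fin.cons (C q⁻¹ * X (Fin.last n)) fun k => X k.castSucc)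

/-- The operator `f ↦ f(x_2, …, x_n, q x_1)`, inverse to `shift`. -/
def unshift (n : ℕ) : PolyRing (n + 1) →ₐ[BaseField] PolyRing (n + 1) :=
  bind₁ (Fin.snoc (fun k => X k.succ) (C q * X 0))

@[simp] theorem shift_X_zero : shift n (X 0) = C q⁻¹ * X (Fin.last n) := by
  simp [shift]

@[simp] theorem shift_X_succ (k : Fin n) : shift n (X k.succ) = X k.castSucc := by
  simp [shift]

@[simp] theorem unshift_X_last : unshift n (X (Fin.last n)) = C q * X 0 := by
  simp [unshift]

@[simp] theorem unshift_X_castSucc (k : Fin n) : unshift n (X k.castSucc) = X k.succ := by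
  simp [unshift]

@[simp] theorem shift_C (c : BaseField) : shift n (C c) = C c := by
  simp [shift]

@[simp] theorem unshift_C (c : BaseField) : unshift n (C c) = C c := by
  simp [unshift]

theorem unshift_shift (f : PolyRing (n + 1)) : unshift n (shift n f) = f := by
  have h : (unshift n).comp (shift n) = AlgHom.id _ _ := by
    apply MvPolynomial.algHom_ext
    intro k
    refine Fin.cases ?_ (fun k => ?_) k
    · simp only [AlgHom.comp_apply, shift_X_zero, map_mul, unshift_C, unshift_X_last, AlgHom.id_apply]
      rw [← mul_assoc, ← C_mul, inv_mul_cancel₀ q_ne_zero, C_1, one_mul]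
    · simp
  exact AlgHom.congr_fun h f

theorem shift_unshift (f : PolyRing (n + 1)) : shift n (unshift n f) = f := by
  have h : (shift n).comp (unshift n) = AlgHom.id _ _ := by
    apply MvPolynomial.algHom_ext
    intro k
    refine Fin.lastCases ?_ (fun k => ?_) k
    · simp only [AlgHom.comp_apply, shift_X_zero, map_mul, shift_C, unshift_X_last, AlgHom.id_apply]
      rw [← mul_assoc, ← C_mul, mul_inv_cancel₀ q_ne_zero, C_1, one_mul]
    · simp
  exact AlgHom.congr_fun h f

theorem eval_shift (v : Fin (n + 1) → BaseField) (f : PolyRing (n + 1)) :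
    eval v (shift n f) = eval (Fin.cons (q⁻¹ * v (Fin.last n)) fun k => v k.castSucc) f := by
  have h : (aeval v).comp (shift n) =
      aeval (Fin.cons (q⁻¹ * v (Fin.last n)) fun k => v k.castSucc : Fin (n + 1) → BaseField) := by
    apply MvPolynomial.algHom_ext
    intro k
    refine Fin.cases ?_ (fun k => ?_) k
    · simp
    · simp
  exact AlgHom.congr_fun h f

theorem eval_point_shift (a : ℕ) (β : Fin n → ℕ) (f : PolyRing (n + 1)) :
    eval (point (Fin.snoc β (a + 1))) (shift n f) = eval (point (Fin.cons a β)) f := by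
  rw [eval_shift]
  congr 2
  funext k
  refine Fin.cases ?_ (fun k => ?_) k
  · rw [Fin.cons_zero, point_snoc_succ_last, inv_mul_cancel_left₀ q_ne_zero]
  · rw [Fin.cons_succ, point_snoc_succ_castSucc]

theorem X_last_mul_shift_mon (c : ℕ) (γ : Fin n → ℕ) :
    X (Fin.last n) * shift n (mon (Fin.cons c γ)) =
      C (q⁻¹ ^ c) * mon (Fin.snoc γ (c + 1)) := by
  rw [mon_eq_prod, mon_eq_prod, map_prod, Fin.prod_univ_succ, Fin.prod_univ_castSucc]
  simp only [map_pow, shift_X_zero, shift_X_succ, Fin.cons_zero, Fin.cons_succ, Fin.snoc_castSucc,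
    Fin.snoc_last, mul_pow]
  ring

theorem shift_mem_low {d : ℕ} {f : PolyRing (n + 1)} (hf : f ∈ low (n + 1) d) :
    shift n f ∈ low (n + 1) d := by
  refine bind₁_mem_low (fun k => ?_) hf
  refine Fin.cases ?_ (fun k => ?_) k
  · rw [Fin.cons_zero]
    exact (totalDegree_mul _ _).trans (by simp)
  · simp

theorem unshift_mem_low {d : ℕ} {f : PolyRing (n + 1)} (hf : f ∈ low (n + 1) d) :
    unshift n f ∈ low (n + 1) d := by
  refine bind₁_mem_low (fun k => ?_) hf
  refine Fin.lastCases ?_ (fun k => ?_) k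
  · rw [Fin.snoc_last]
    exact (totalDegree_mul _ _).trans (by simp)
  · simp

theorem X_last_mul_shift_mem_hom {d : ℕ} {f : PolyRing (n + 1)} (hf : f ∈ hom (n + 1) d) :
    X (Fin.last n) * shift n f ∈ hom (n + 1) (d + 1) := by
  refine map_mem_supp ((LinearMap.mulLeft BaseField (X (Fin.last n))).comp
    (shift n).toLinearMap) (fun γ hγ => ?_) hf
  change X (Fin.last n) * shift n (mon γ) ∈ _
  rw [← Fin.cons_self_tail γ] at hγ ⊢
  rw [X_last_mul_shift_mon]
  refine C_mul_mem_supp _ (mon_mem_supp ?_)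
  rw [size_cons] at hγ
  rw [size_snoc]
  omega

theorem X_last_mul_shift_mem_below {a : ℕ} {β : Fin n → ℕ} {f : PolyRing (n + 1)}
    (hf : f ∈ supp fun γ => Below γ (Fin.cons a β)) :
    X (Fin.last n) * shift n f ∈ supp fun γ => Below γ (Fin.snoc β (a + 1)) := by
  refine map_mem_supp ((LinearMap.mulLeft BaseField (X (Fin.last n))).comp
    (shift n).toLinearMap) (fun γ hγ => ?_) hf
  change X (Fin.last n) * shift n (mon γ) ∈ _
  rw [← Fin.cons_self_tail γ] at hγ ⊢
  rw [X_last_mul_shift_mon]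
  exact C_mul_mem_supp _ (mon_mem_supp (below_snoc_succ hγ))

theorem coeff_X_last_mul_shift (a : ℕ) (β : Fin n → ℕ) (f : PolyRing (n + 1)) :
    coeff (Finsupp.equivFunOnFinite.symm (Fin.snoc β (a + 1))) (X (Fin.last n) * shift n f) =
      q⁻¹ ^ a * coeff (Finsupp.equivFunOnFinite.symm (Fin.cons a β)) f := by
  have h0 : f ∈ supp fun _ => True := mem_supp.2 fun _ _ => trivial
  have h1 := sub_coeff_mul_mon_mem_supp h0 (Fin.cons a β)
  have h2 : X (Fin.last n) * shift n
      (f - C (coeff (Finsupp.equivFunOnFinite.symm (Fin.cons a β)) f) * mon (Fin.cons a β)) ∈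
      supp fun γ => γ ≠ Fin.snoc β (a + 1) := by
    refine map_mem_supp ((LinearMap.mulLeft BaseField (X (Fin.last n))).comp
      (shift n).toLinearMap) (fun γ hγ => ?_) h1
    change X (Fin.last n) * shift n (mon γ) ∈ _
    rw [← Fin.cons_self_tail γ] at hγ ⊢
    rw [X_last_mul_shift_mon]
    refine C_mul_mem_supp _ (mon_mem_supp fun he => hγ.2 ?_)
    have e1 := congrFun he (Fin.last n)
    have e2 := fun k : Fin n => congrFun he k.castSucc
    simp only [Fin.snoc_last, Fin.snoc_castSucc] at e1 e2
    rw [Nat.succ_injective e1, funext e2]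
  have h3 := coeff_eq_zero_of_mem_supp h2 (α := Fin.snoc β (a + 1)) (by simp)
  rw [map_sub, map_mul, shift_C, mul_sub, mul_left_comm, X_last_mul_shift_mon, coeff_sub,
    coeff_C_mul, coeff_C_mul, sub_eq_zero] at h3
  rw [h3]
  simp [mon]
  ring

end Shift

/-! ### Uniqueness of interpolation -/

theorem totalDegree_X_sub_C {n : ℕ} (k : Fin n) (c : BaseField) :
    (X k - C c : PolyRing n).totalDegree = 1 := by
  refine le_antisymm ((totalDegree_sub_C_le _ _).trans (totalDegree_X k).le) ?_
  have h := totalDegree_add (X k - C c : PolyRing n) (C c)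
  rwa [sub_add_cancel, totalDegree_X, totalDegree_C, Nat.max_zero] at h

theorem exists_eq_X_last_sub_C_mul {n : ℕ} {f : PolyRing (n + 1)} {c : BaseField}
    (h : bind₁ (Fin.snoc X (C c) : Fin (n + 1) → PolyRing n) f = 0) :
    ∃ g, f = (X (Fin.last n) - C c) * g := by
  have hd := dvd_sub_map_of_forall_X (A := (X (Fin.last n) - C c : PolyRing (n + 1)))
    ((rename Fin.castSucc).comp (bind₁ (Fin.snoc X (C c) : Fin (n + 1) → PolyRing n)))
    (fun k => by
      refine Fin.lastCases ?_ (fun k => ?_) k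
      · simp
      · simp) f
  rwa [AlgHom.comp_apply, h, map_zero, sub_zero] at hd

/-- Double induction. Compositions ending in 0 have spectral vectors on the hyperplane where the
last variable is t^(-n), where they are the points for one variable fewer. Compositions with
positive last entry lie off this hyperplane and correspond, by the affine shift, to all compositions
of size one less. -/
theorem eq_zero_of_vanishing {n d : ℕ} {f : PolyRing n} (hf : f ∈ low n d)
    (h : ∀ β, size β < d → eval (point β) f = 0) : f = 0 := by
  induction n generalizing d with
  | zero =>
    rcases d with _ | d
    · exact eq_zero_of_mem_low_zero hf
    · have h0 := h Fin.elim0 (by simp [size])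
      rw [eq_C_of_isEmpty f, eval_C] at h0
      rw [eq_C_of_isEmpty f, h0, C_0]
  | succ n ihn =>
    induction d generalizing f with
    | zero => exact eq_zero_of_mem_low_zero hf
    | succ d ihd =>
      -- Induction on the number of variables kills the restriction to the hyperplane, so `f` is
      -- divisible by its equation.
      have hr : bind₁ (Fin.snoc X (C (t ^ (-(n : ℤ)))) : Fin (n + 1) → PolyRing n) f = 0 := by
        refine ihn (bind₁_mem_low (fun k => ?_) hf) fun β hβ => ?_
        · refine Fin.lastCases ?_ (fun k => ?_) k <;> simp
        · have h0 := h (Fin.snoc β 0) (by rwa [size_snoc])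
          have hc : (aeval (point β)).comp
              (bind₁ (Fin.snoc X (C (t ^ (-(n : ℤ)))) : Fin (n + 1) → PolyRing n)) =
              aeval (point (Fin.snoc β 0 : Fin (n + 1) → ℕ)) := by
            apply MvPolynomial.algHom_ext
            intro k
            refine Fin.lastCases ?_ (fun k => ?_) k
            · simp [point_snoc_zero_last]
            · simp [point_snoc_zero_castSucc]
          exact (AlgHom.congr_fun hc f).trans h0
      obtain ⟨g, rfl⟩ := exists_eq_X_last_sub_C_mul hr
      have hg : g ∈ low (n + 1) d := by
        by_cases hg0 : g = 0
        · rw [hg0]; exact Submodule.zero_mem _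
        have hne : (X (Fin.last n) - C (t ^ (-(n : ℤ))) : PolyRing (n + 1)) ≠ 0 := by
          intro h0
          have := totalDegree_X_sub_C (Fin.last n) (t ^ (-(n : ℤ)))
          rw [h0, totalDegree_zero] at this
          omega
        rw [mem_low_succ, totalDegree_mul_of_isDomain hne hg0, totalDegree_X_sub_C] at hf
        obtain ⟨d, rfl⟩ : ∃ d', d = d' + 1 := ⟨d - 1, by omega⟩
        rw [mem_low_succ]
        omega
      have h0 : unshift n g = 0 := by
        refine ihd (unshift_mem_low hg) fun γ hγ => ?_
        rw [← Fin.cons_self_tail γ] at hγ ⊢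
        rw [size_cons] at hγ
        rw [← eval_point_shift, shift_unshift]
        have h0 := h (Fin.snoc (Fin.tail γ) (γ 0 + 1)) (by rw [size_snoc]; omega)
        rw [eval_mul, eval_sub, eval_X, eval_C] at h0
        exact (mul_eq_zero.1 h0).resolve_left (point_snoc_succ_last_ne _ _)
      rw [← shift_unshift g, h0, map_zero, mul_zero]

/-! ### Interpolation polynomials and the action of H_i on vanishing conditions -/

section Interpolation

variable {n : ℕ} {α : Fin n → ℕ}

theorem IsInterpolation.mem_low {G : PolyRing n} (h : IsInterpolation α G) :
    G ∈ low n (size α + 1) :=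
  mem_low_succ.2 h.degree_le

theorem IsInterpolation.ne_zero {G : PolyRing n} (h : IsInterpolation α G) : G ≠ 0 := by
  rintro rfl
  simpa using h.coeff_eq_one

theorem IsInterpolation.eval_ne_zero {G : PolyRing n} (h : IsInterpolation α G) :
    eval (point α) G ≠ 0 := by
  intro h0
  refine h.ne_zero (eq_zero_of_vanishing h.mem_low fun β hβ => ?_)
  by_cases hβα : β = α
  · rw [hβα, h0]
  · exact h.vanishing β (Nat.lt_succ_iff.1 hβ) hβα

/-- A polynomial with the vanishing property of `G_α` is a multiple of `G_α`. -/
theorem IsInterpolation.eq_C_mul {G F : PolyRing n} (h : IsInterpolation α G)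
    (hF : F ∈ low n (size α + 1))
    (hv : ∀ β, size β ≤ size α → β ≠ α → eval (point β) F = 0) :
    F = C (eval (point α) F / eval (point α) G) * G := by
  rw [← sub_eq_zero]
  refine eq_zero_of_vanishing (Submodule.sub_mem _ hF (C_mul_mem_supp _ h.mem_low)) fun β hβ => ?_
  rw [eval_sub, eval_mul, eval_C]
  by_cases hβα : β = α
  · rw [hβα, div_mul_cancel₀ _ h.eval_ne_zero, sub_self]
  · rw [hv β (Nat.lt_succ_iff.1 hβ) hβα,
      show eval (point β) G = 0 from h.vanishing β (Nat.lt_succ_iff.1 hβ) hβα, mul_zero, sub_zero]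

theorem IsInterpolation.unique {G F : PolyRing n} (h : IsInterpolation α G)
    (hF : IsInterpolation α F) : F = G := by
  have e := h.eq_C_mul hF.mem_low hF.vanishing
  have h1 := hF.coeff_eq_one
  rw [e, coeff_C_mul, h.coeff_eq_one, mul_one] at h1
  rw [e, h1, C_1, one_mul]

theorem eval_demLus_eq_zero (s : BaseField) {i : Fin (n - 1)} {β : Fin n → ℕ} {f : PolyRing n}
    (h : β (lo i) ≠ β (hi i)) (h1 : eval (point β) f = 0)
    (h2 : eval (point (β ∘ simple i)) f = 0) : eval (point β) (demLus s i f) = 0 := by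
  have e := mul_eval_demLus s i (point β) f
  rw [← point_comp_simple h, h1, h2, mul_zero, mul_zero, sub_zero] at e
  exact (mul_eq_zero.1 e).resolve_left (point_lo_ne_point_hi β i)

/-- Here s_i β̄ need not be a spectral vector, but its coefficient β̄_i - t β̄_{i+1} is zero. This
forces the parameter to be `t`. -/
theorem eval_demLus_eq_zero_of_eq {i : Fin (n - 1)} {β : Fin n → ℕ} {f : PolyRing n}
    (h : β (lo i) = β (hi i)) (h1 : eval (point β) f = 0) :
    eval (point β) (demLus t i f) = 0 := by
  have e := mul_eval_demLus t i (point β) f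
  rw [h1, point_lo_of_eq h, sub_self, zero_mul, mul_zero, sub_zero, ← point_lo_of_eq h] at e
  exact (mul_eq_zero.1 e).resolve_left (point_lo_ne_point_hi β i)

theorem eval_demLusWord_eq_zero {d : ℕ} {f : PolyRing n}
    (h : ∀ β, size β < d → eval (point β) f = 0) (l : List (Fin (n - 1))) (β : Fin n → ℕ)
    (hβ : size β < d) : eval (point β) (demLusWord t l f) = 0 := by
  induction l generalizing β with
  | nil => exact h β hβ
  | cons i l ih =>
    rw [demLusWord_cons]
    by_cases he : β (lo i) = β (hi i)
    · exact eval_demLus_eq_zero_of_eq he (ih β hβ)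
    · exact eval_demLus_eq_zero t he (ih β hβ) (ih _ (by rwa [size_comp]))

end Interpolation

section Words

variable {n : ℕ}

/-! ### Words of Demazure–Lusztig operators and the affine shift -/

theorem simple_lo_castSucc (i : Fin (n - 1)) (k : Fin n) :
    simple (n := n + 1) (lo i) k.castSucc = (simple i k).castSucc := by
  have h := wordPerm_map_lo_castSucc [i] k
  rw [List.map_singleton, wordPerm_singleton] at h
  rw [h, wordPerm_singleton]

theorem simple_hi_succ (i : Fin (n - 1)) (k : Fin n) :
    simple (n := n + 1) (hi i) k.succ = (simple i k).succ := by
  have h := wordPerm_map_hi_succ [i] k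
  rw [List.map_singleton, wordPerm_singleton] at h
  rw [h, wordPerm_singleton]

theorem simple_lo_last (i : Fin (n - 1)) :
    simple (n := n + 1) (lo i) (Fin.last n) = Fin.last n :=
  simple_of_ne (Fin.castSucc_lt_last (lo i)).ne' (Fin.castSucc_lt_last (hi i)).ne'

theorem simple_hi_zero (i : Fin (n - 1)) : simple (n := n + 1) (hi i) 0 = 0 :=
  simple_of_ne (Fin.succ_ne_zero (lo i)).symm (Fin.succ_ne_zero (hi i)).symm

theorem unshift_rename_simple (i : Fin (n - 1)) (f : PolyRing (n + 1)) :
    unshift n (rename (simple (n := n + 1) (lo i)) f) =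
      rename (simple (n := n + 1) (hi i)) (unshift n f) := by
  have h : (unshift n).comp (rename (simple (n := n + 1) (lo i))) =
      (rename (simple (n := n + 1) (hi i))).comp (unshift n) := by
    apply MvPolynomial.algHom_ext
    intro k
    refine Fin.lastCases ?_ (fun k => ?_) k
    · simp [simple_lo_last, simple_hi_zero]
    · simp [simple_lo_castSucc, simple_hi_succ]
  exact AlgHom.congr_fun h f

theorem unshift_demLus (s : BaseField) (i : Fin (n - 1)) (f : PolyRing (n + 1)) :
    unshift n (demLus (n := n + 1) s (lo i) f) = demLus (n := n + 1) s (hi i) (unshift n f) := by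
  refine map_demLus (unshift n).toRingHom (u := 1) one_ne_zero ?_ ?_ ?_ ?_ f
  · rw [one_mul]
    exact unshift_X_castSucc (lo i)
  · rw [one_mul]
    exact unshift_X_castSucc (hi i)
  · exact unshift_C s
  · exact unshift_rename_simple i

theorem unshift_demLusWord (s : BaseField) (l : List (Fin (n - 1))) (f : PolyRing (n + 1)) :
    unshift n (demLusWord (n := n + 1) s (l.map lo) f) =
      demLusWord (n := n + 1) s (l.map hi) (unshift n f) := by
  induction l with
  | nil => rfl
  | cons i l ih =>
    rw [List.map_cons, List.map_cons]
    refine (congrArg _ (demLusWord_cons (n := n + 1) s (lo i) _ f)).trans ?_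
    rw [unshift_demLus, ih]
    exact (demLusWord_cons (n := n + 1) s (hi i) _ _).symm

theorem demLusWord_map_hi_X_zero_mul (s : BaseField) (l : List (Fin (n - 1)))
    (f : PolyRing (n + 1)) :
    demLusWord (n := n + 1) s (l.map hi) (X 0 * f) =
      X 0 * demLusWord (n := n + 1) s (l.map hi) f := by
  induction l with
  | nil => rfl
  | cons i l ih =>
    rw [List.map_cons]
    refine (demLusWord_cons (n := n + 1) s (hi i) _ _).trans ?_
    rw [ih, demLus_mul_of_symm (n := n + 1) s (i := hi i) (by rw [rename_X, simple_hi_zero])]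
    exact congrArg _ (demLusWord_cons (n := n + 1) s (hi i) _ _).symm

/-- Reversing the variables reverses the direction of the cyclic shift and ι inverts q, so the shift
becomes its inverse. -/
theorem rename_longest_circ_shift (f : PolyRing (n + 1)) :
    rename (longest (n + 1)) (circ (shift n f)) =
      unshift n (rename (longest (n + 1)) (circ f)) := by
  have h : ((rename (longest (n + 1))).toRingHom.comp (map iota)).comp (shift n).toRingHom =
      ((unshift n).toRingHom.comp (rename (longest (n + 1))).toRingHom).comp (map iota) := by
    apply MvPolynomial.ringHom_ext
    · intro r
      simp
    · intro k
      refine Fin.cases ?_ (fun k => ?_) k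
      · simp [longest_apply, iota_q]
      · simp [longest_apply, Fin.rev_castSucc, Fin.rev_succ]
  exact RingHom.congr_fun h f

theorem X_lo_dvd_demLus_sub (s : BaseField) (i : Fin (n - 1)) (f : PolyRing n) :
    X (lo i) ∣ demLus s i f - C s * rename (simple i) f :=
  ⟨-C (1 - s) * divDiff i f, by simp only [demLus, LinearMap.coe_mk, AddHom.coe_mk]; ring⟩

/-- Modulo x_i the operator H_i is s times s_i, and s_i carries a congruence modulo x_{i+1} to one
modulo x_i. Suffixes of the word are therefore treated from the last letter backwards. -/
theorem X_dvd_demLusWord_drop_sub (s : BaseField) (g : PolyRing (n + 1)) (k : ℕ) (hk : k ≤ n) :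
    X (⟨n - k, by omega⟩ : Fin (n + 1)) ∣
      demLusWord (n := n + 1) s ((List.finRange n).drop (n - k)) g -
        C (s ^ k) * rename (wordPerm (n := n + 1) ((List.finRange n).drop (n - k))) g := by
  induction k with
  | zero =>
    rw [show (List.finRange n).drop (n - 0) = [] from List.drop_eq_nil_of_le (by simp)]
    refine (dvd_zero _).trans (dvd_of_eq ?_)
    refine (sub_eq_zero.2 ?_).symm
    rw [pow_zero, C_1, one_mul]
    exact (rename_id_apply g).symm
  | succ k ih =>
    have ih := ih (by omega)
    have e : n - k = n - (k + 1) + 1 := by omega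
    have hd : (List.finRange n).drop (n - (k + 1)) =
        (⟨n - (k + 1), by omega⟩ : Fin n) :: (List.finRange n).drop (n - k) := by
      rw [List.drop_eq_getElem_cons (by simp; omega), e]
      simp
    rw [hd]
    set l := (List.finRange n).drop (n - k)
    set i : Fin n := ⟨n - (k + 1), by omega⟩ with hi'
    have hw : wordPerm (n := n + 1) (i :: l) = simple (n := n + 1) i * wordPerm (n := n + 1) l :=
      wordPerm_cons (n := n + 1) i l
    have hT : demLusWord (n := n + 1) s (i :: l) g =
        demLus (n := n + 1) s i (demLusWord (n := n + 1) s l g) :=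
      demLusWord_cons (n := n + 1) s i l g
    have h1 := X_lo_dvd_demLus_sub (n := n + 1) s i (demLusWord (n := n + 1) s l g)
    have h2 := map_dvd (rename (simple (n := n + 1) i)) ih
    have hX : (⟨n - k, by omega⟩ : Fin (n + 1)) = hi (n := n + 1) i := by
      simp only [hi, hi', Fin.ext_iff]; omega
    rw [rename_X, hX, simple_hi, map_sub, map_mul, rename_C, rename_rename,
      ← Equiv.Perm.coe_mul, ← hw] at h2
    rw [hT]
    have h3 := dvd_add h1 (h2.mul_left (C s))
    convert! h3 using 1
    rw [pow_succ, C_mul]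
    ring

theorem X_zero_dvd_demLusWord_sub (s : BaseField) (g : PolyRing (n + 1)) :
    X 0 ∣ demLusWord (n := n + 1) s (List.finRange n) g -
      C (s ^ n) * rename (wordPerm (n := n + 1) (List.finRange n)) g := by
  have h := X_dvd_demLusWord_drop_sub s g n le_rfl
  simpa only [Nat.sub_self, List.drop_zero, Fin.mk_zero] using h

theorem demLusWord_drop_telescope (s : BaseField) (f : PolyRing (n + 1)) (k : ℕ) (hk : k ≤ n) :
    demLusWord (n := n + 1) s ((List.finRange n).drop (n - k)) (X (Fin.last n) *
      demLusWord (n := n + 1) s ((List.finRange n).drop (n - k)).reverse f) =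
      C (s ^ k) * (X (⟨n - k, by omega⟩ : Fin (n + 1)) * f) := by
  induction k generalizing f with
  | zero =>
    rw [show (List.finRange n).drop (n - 0) = [] from List.drop_eq_nil_of_le (by simp), pow_zero,
      C_1, one_mul]
    rfl
  | succ k ih =>
    have ih := fun f => ih f (by omega)
    have e : n - k = n - (k + 1) + 1 := by omega
    have hd : (List.finRange n).drop (n - (k + 1)) =
        (⟨n - (k + 1), by omega⟩ : Fin n) :: (List.finRange n).drop (n - k) := by
      rw [List.drop_eq_getElem_cons (by simp; omega), e]
      simp
    rw [hd]
    set l := (List.finRange n).drop (n - k)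
    set i : Fin n := ⟨n - (k + 1), by omega⟩ with hi'
    have hX : (⟨n - k, by omega⟩ : Fin (n + 1)) = hi (n := n + 1) i := by
      simp only [hi, hi', Fin.ext_iff]; omega
    have hT : ∀ g, demLusWord (n := n + 1) s (i :: l) g =
        demLus (n := n + 1) s i (demLusWord (n := n + 1) s l g) :=
      demLusWord_cons (n := n + 1) s i l
    have hR : demLusWord (n := n + 1) s (i :: l).reverse f =
        demLusWord (n := n + 1) s l.reverse (demLus (n := n + 1) s i f) := by
      rw [List.reverse_cons]
      refine (demLusWord_append (n := n + 1) s _ _ f).trans ?_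
      exact congrArg _ (demLusWord_cons (n := n + 1) s i [] f)
    rw [hT, hR, ih, hX, ← smul_eq_C_mul, map_smul, demLus_X_hi_mul_demLus, smul_eq_C_mul,
      ← mul_assoc, ← C_mul, pow_succ]
    rfl

theorem demLusWord_telescope (s : BaseField) (f : PolyRing (n + 1)) :
    demLusWord (n := n + 1) s (List.finRange n) (X (Fin.last n) *
      demLusWord (n := n + 1) s (List.finRange n).reverse f) = C (s ^ n) * (X 0 * f) := by
  have h := demLusWord_drop_telescope s f n le_rfl
  simpa only [Nat.sub_self, List.drop_zero, Fin.mk_zero] using h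

theorem X_mul_mem_hom (k : Fin n) {d : ℕ} {f : PolyRing n} (hf : f ∈ hom n d) :
    X k * f ∈ hom n (d + 1) := by
  refine map_mem_supp (LinearMap.mulLeft BaseField (X k)) (fun γ hγ => ?_) hf
  rw [LinearMap.mulLeft_apply, ← pow_one (X k), ← mon_single, ← mon_add]
  refine mon_mem_supp ?_
  rw [← hγ, size, size]
  simp [Finset.sum_add_distrib, add_comm]

theorem mem_low_of_X_mul_mem_low (k : Fin n) {d : ℕ} {f : PolyRing n}
    (hf : X k * f ∈ low n (d + 1)) : f ∈ low n d := by
  by_cases h0 : f = 0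
  · rw [h0]; exact Submodule.zero_mem _
  rw [mem_low_succ, totalDegree_mul_of_isDomain (X_ne_zero k) h0, totalDegree_X] at hf
  obtain ⟨d, rfl⟩ : ∃ d', d = d' + 1 := ⟨d - 1, by omega⟩
  rw [mem_low_succ]
  omega

theorem circ_demLus (i : Fin (n - 1)) (f : PolyRing n) :
    circ (demLus t i f) = demLus t⁻¹ i (circ f) := by
  refine map_demLus (map iota) (u := 1) one_ne_zero ?_ ?_ ?_ (circ_rename _) f
  · simp
  · simp
  · simp [iota_t]

theorem iota_point (β : Fin n → ℕ) (k : Fin n) : iota (point β k) = (point β k)⁻¹ := by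
  rw [point_apply, map_mul, map_zpow₀, map_zpow₀, iota_q, iota_t, mul_inv, inv_zpow, inv_zpow]

end Words

section Main

variable {n : ℕ}

/-! ### Construction of the interpolation polynomials -/

/-- `G` is the interpolation polynomial of index `α` and `E` is its top homogeneous part, which is
triangular and satisfies the symmetry under inversion of `q` and `t`. -/
structure IsTriangular (α : Fin n → ℕ) (G E : PolyRing n) : Prop where
  isInterpolation : IsInterpolation α G
  below : E ∈ supp fun γ => Below γ α
  sub_mem : G - E ∈ low n (size α)
  inversion : ∀ l, IsReducedWord l (longest n) →
    demLusWord t l E = C (t ^ invCount α) * rename (longest n) (circ E)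

namespace IsTriangular

variable {α : Fin n → ℕ} {G E : PolyRing n}

theorem mem_hom (h : IsTriangular α G E) : E ∈ hom n (size α) :=
  supp_mono (fun _ hγ => hγ.1) h.below

theorem coeff_eq_one (h : IsTriangular α G E) :
    coeff (Finsupp.equivFunOnFinite.symm α) E = 1 := by
  have h1 := coeff_eq_zero_of_mem_supp h.sub_mem (α := α) (lt_irrefl _)
  rw [coeff_sub, h.isInterpolation.coeff_eq_one, sub_eq_zero] at h1
  exact h1.symm

theorem of_size_eq_zero (h : size α = 0) : IsTriangular α (1 : PolyRing n) 1 := by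
  have hα : α = 0 := by
    funext k
    exact (Finset.sum_eq_zero_iff.1 h) k (Finset.mem_univ k)
  subst hα
  have h1 : (1 : PolyRing n) = mon 0 := by simp [mon_eq_prod]
  refine ⟨⟨by simp, ?_, ?_⟩, ?_, ?_, ?_⟩
  · intro β hβ hne
    refine absurd (funext fun k => ?_) hne
    rw [h, Nat.le_zero] at hβ
    exact (Finset.sum_eq_zero_iff.1 hβ) k (Finset.mem_univ k)
  · rw [h1, mon, coeff_monomial, if_pos rfl]
  · rw [h1]
    exact mon_mem_supp ⟨rfl, fun _ _ => le_rfl⟩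
  · rw [sub_self]
    exact Submodule.zero_mem _
  · intro l hl
    rw [demLusWord_one, (isReducedWord_iff.1 hl).2, inversions_longest, circ, map_one, map_one,
      mul_one]
    rfl

/-- H_i G can be nonzero only at ᾱ and at the spectral vector of s_i α among the points in question;
adding a multiple of G removes the value at ᾱ. -/
theorem comp_simple (h : IsTriangular α G E) {i : Fin (n - 1)} (hi : α (lo i) < α (hi i)) :
    ∃ G' E', IsTriangular (α ∘ simple i) G' E' := by
  set a := point α (lo i) with ha
  set b := point α (InterpolationMacdonald.hi i) with hb
  have ha0 : a ≠ 0 := point_ne_zero _ _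
  have hb0 : b ≠ 0 := point_ne_zero _ _
  have hab : a - b ≠ 0 := point_lo_ne_point_hi α i
  -- At ᾱ the value of H_i G is -c G(ᾱ), as G vanishes at the spectral vector of s_i α.
  set c : BaseField := (1 - t) * a / (a - b) with hc
  -- Exactly this relation turns t w₀ (H_i° + ι(c)) into (H_{n-i} + c) w₀.
  have hιc : t * iota c = c - (1 - t) := by
    have ht := t_ne_zero
    have hab' : a⁻¹ - b⁻¹ ≠ 0 := by
      rw [inv_sub_inv ha0 hb0]
      refine div_ne_zero ?_ (mul_ne_zero ha0 hb0)
      rw [← neg_sub]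
      exact neg_ne_zero.2 hab
    rw [hc, map_div₀, map_mul, map_sub, map_sub, map_one, iota_t, ha, hb, iota_point, iota_point,
      ← ha, ← hb, inv_sub_inv ha0 hb0]
    have hba : b - a ≠ 0 := by
      rw [← neg_sub]
      exact neg_ne_zero.2 hab
    rw [← neg_sub a b]
    field_simp
    ring
  have hlow : demLus t i (G - E) + C c * (G - E) ∈ low n (size (α ∘ simple i)) := by
    rw [size_comp]
    exact Submodule.add_mem _ (demLus_mem_supp_size t i (· < size α) h.sub_mem)
      (C_mul_mem_supp _ h.sub_mem)
  have hbelow : demLus t i E + C c * E ∈ supp fun γ => Below γ (α ∘ simple i) :=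
    Submodule.add_mem _ (demLus_mem_below t hi h.below)
      (C_mul_mem_supp _ (mem_below_comp_simple hi h.below))
  have hsub : (demLus t i G + C c * G) - (demLus t i E + C c * E) =
      demLus t i (G - E) + C c * (G - E) := by
    rw [map_sub]
    ring
  have hne : α ∘ simple i ≠ α := by
    intro he
    have := congrFun he (lo i)
    rw [Function.comp_apply, simple_lo] at this
    omega
  refine ⟨demLus t i G + C c * G, demLus t i E + C c * E, ⟨?_, ?_, ?_⟩, hbelow, ?_, ?_⟩
  · rw [← mem_low_succ, size_comp]
    exact Submodule.add_mem _
      (demLus_mem_supp_size t i (· < size α + 1) h.isInterpolation.mem_low)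
      (C_mul_mem_supp _ h.isInterpolation.mem_low)
  · intro β hβ hβα
    rw [size_comp] at hβ
    change eval (point β) _ = 0
    rw [eval_add, eval_mul, eval_C]
    have hv := h.isInterpolation.vanishing
    by_cases he : β = α
    · subst he
      have e := mul_eval_demLus t i (point β) G
      have h0 : eval (point (β ∘ simple i)) G = 0 := hv _ (by rw [size_comp]) hne
      rw [← point_comp_simple hi.ne, h0, mul_zero, zero_sub, ← ha, ← hb] at e
      apply mul_left_cancel₀ hab
      rw [mul_add, e, hc]
      field_simp
      ring
    · have h0 : eval (point β) G = 0 := hv β hβ he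
      rw [h0, mul_zero, add_zero]
      by_cases hβi : β (lo i) = β (InterpolationMacdonald.hi i)
      · exact eval_demLus_eq_zero_of_eq hβi h0
      · refine eval_demLus_eq_zero t hβi h0 (hv _ (by rwa [size_comp]) fun he => hβα ?_)
        rw [← he, comp_simple_comp_simple]
  · have h1 := coeff_eq_zero_of_mem_supp hlow (α := α ∘ simple i) (lt_irrefl _)
    rw [← hsub, coeff_sub, sub_eq_zero] at h1
    rw [h1, coeff_add, coeff_C_mul, coeff_demLus_of_triangular t hi h.below, h.coeff_eq_one,
      coeff_eq_zero_of_mem_supp h.below (not_below_comp_simple hi), mul_zero, add_zero]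
  · rw [hsub]
    exact hlow
  · intro l hl
    have hE := h.inversion l hl
    have hT := rename_longest_demLus i (circ E)
    have hιc' : (C t * C (iota c) : PolyRing n) = C c - C (1 - t) := by
      rw [← C_mul, hιc, C_sub]
    have hcirc : circ (demLus t i E + C c * E) =
        demLus t⁻¹ i (circ E) + C (iota c) * circ E := by
      rw [← circ_demLus]
      simp [circ]
    rw [hcirc, map_add, demLusWord_demLus_of_longest t hl, ← smul_eq_C_mul _ c, map_smul, hE,
      map_add, map_mul (rename _), rename_C, invCount_comp_simple hi,
      ← smul_eq_C_mul _ (t ^ invCount α), map_smul, smul_eq_C_mul, smul_eq_C_mul, smul_eq_C_mul,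
      pow_succ, C_mul]
    linear_combination -C (t ^ invCount α) * hT -
      C (t ^ invCount α) * rename (longest n) (circ E) * hιc'

end IsTriangular

/-! ### The affine step -/

theorem rename_wordPerm_finRange_shift (g : PolyRing (n + 1)) :
    (X 0 : PolyRing (n + 1)) ∣
      g - rename (wordPerm (n := n + 1) (List.finRange n)) (shift n g) := by
  refine dvd_sub_map_of_forall_X
    ((rename (wordPerm (n := n + 1) (List.finRange n))).comp (shift n)) (fun k => ?_) g
  refine Fin.cases ?_ (fun k => ?_) k
  · rw [AlgHom.comp_apply, shift_X_zero, map_mul, rename_C, rename_X, (wordPerm_finRange n).1]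
    exact ⟨1 - C q⁻¹, by ring⟩
  · rw [AlgHom.comp_apply, shift_X_succ, rename_X, (wordPerm_finRange n).2, sub_self]
    exact dvd_zero _

/-- The raising operator `f ↦ (x_n - t^(1-n)) f(x_n / q, x_1, …, x_(n-1))`. -/
def raiseOp (n : ℕ) (f : PolyRing (n + 1)) : PolyRing (n + 1) :=
  (X (Fin.last n) - C (t ^ (-(n : ℤ)))) * shift n f

/-- Modulo x_1 the word acts as t^n times a cycle that undoes the shift. The factor x_{n+1} - t^(-n)
becomes -t^(-n), so the second term reduces to -G. -/
theorem X_zero_dvd_add_demLusWord_raise (G : PolyRing (n + 1)) :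
    X 0 ∣ G + demLusWord (n := n + 1) t (List.finRange n) (raiseOp n G) := by
  have h1 := X_zero_dvd_demLusWord_sub t (raiseOp n G)
  have h2 := rename_wordPerm_finRange_shift G
  have h3 : (C (t ^ n) * C (t ^ (-(n : ℤ))) : PolyRing (n + 1)) = 1 := by
    rw [← C_mul, ← zpow_natCast, ← zpow_add₀ t_ne_zero]
    simp
  obtain ⟨A, hA⟩ := h1
  obtain ⟨B, hB⟩ := h2
  have hr : rename (wordPerm (n := n + 1) (List.finRange n)) (raiseOp n G) =
      (X 0 - C (t ^ (-(n : ℤ)))) *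
        rename (wordPerm (n := n + 1) (List.finRange n)) (shift n G) := by
    rw [raiseOp, map_mul, map_sub, rename_C, rename_X, (wordPerm_finRange n).1]
  rw [hr] at hA
  refine ⟨A + B + C (t ^ n) *
    rename (wordPerm (n := n + 1) (List.finRange n)) (shift n G), ?_⟩
  linear_combination hA + hB -
    rename (wordPerm (n := n + 1) (List.finRange n)) (shift n G) * h3

theorem raise_mem_low {d : ℕ} {f : PolyRing (n + 1)} (hf : f ∈ low (n + 1) d) :
    raiseOp n f ∈ low (n + 1) (d + 1) :=
  mul_mem_low (totalDegree_X_sub_C _ _).le (shift_mem_low hf)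

theorem eval_raise_eq_zero {α : Fin (n + 1) → ℕ} {G : PolyRing (n + 1)}
    (h : IsInterpolation α G) {β : Fin (n + 1) → ℕ} (hβ : size β ≤ size α + 1)
    (hne : β ≠ Fin.snoc (Fin.tail α) (α 0 + 1)) : eval (point β) (raiseOp n G) = 0 := by
  rw [← Fin.snoc_init_self β] at hβ hne ⊢
  rw [raiseOp, eval_mul]
  rcases hb : β (Fin.last n) with _ | b
  · rw [eval_sub, eval_X, eval_C, point_snoc_zero_last, sub_self, zero_mul]
  · rw [hb] at hβ hne
    rw [eval_point_shift]
    rw [size_snoc] at hβ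
    refine mul_eq_zero_of_right _ (h.vanishing _ (by rw [size_cons]; omega) fun he => hne ?_)
    rw [← he, Fin.tail_cons, Fin.cons_zero]

/-- Write the left side as x_1 M with M of degree at most |α|. The raised polynomial, and hence its
image under the word, vanishes at every β̄ with |β| ≤ |α|, so β̄_1 M(β̄) = G(β̄) there. Thus M has
the zeros of G and is G / ᾱ_1. -/
theorem demLusWord_raise {α : Fin (n + 1) → ℕ} {G : PolyRing (n + 1)} (h : IsInterpolation α G) :
    G + demLusWord (n := n + 1) t (List.finRange n) (raiseOp n G) =
      C (point α 0)⁻¹ * (X 0 * G) := by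
  obtain ⟨M, hM⟩ := X_zero_dvd_add_demLusWord_raise G
  have hlow : M ∈ low (n + 1) (size α + 1) := by
    apply mem_low_of_X_mul_mem_low 0
    rw [← hM]
    exact Submodule.add_mem _ (supp_mono (fun _ hγ => Nat.lt_succ_of_lt hγ) h.mem_low)
      (demLusWord_mem_supp_size (n := n + 1) t _ (· < size α + 1 + 1) (raise_mem_low h.mem_low))
  have hv : ∀ β, size β ≤ size α → point β 0 * eval (point β) M = eval (point β) G := by
    intro β hβ
    have h0 := eval_demLusWord_eq_zero (n := n + 1) (d := size α + 1) (f := raiseOp n G)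
      (fun β hβ => eval_raise_eq_zero h hβ.le fun he => ?_) (List.finRange n) β
      (Nat.lt_succ_of_le hβ)
    · have := congrArg (eval (point β)) hM
      rw [eval_add, h0, add_zero, eval_mul, eval_X] at this
      exact this.symm
    · rw [he, size_snoc] at hβ
      conv_rhs at hβ => rw [← Fin.cons_self_tail α, size_cons]
      omega
  have hM' := h.eq_C_mul hlow fun β hβ hne =>
    (mul_eq_zero.1 ((hv β hβ).trans (h.vanishing β hβ hne))).resolve_left (point_ne_zero β 0)
  rw [← hv α le_rfl, div_mul_cancel_right₀ (right_ne_zero_of_mul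
    ((hv α le_rfl).trans_ne h.eval_ne_zero))] at hM'
  rw [hM, hM']
  ring

namespace IsTriangular

variable {α : Fin (n + 1) → ℕ} {G E : PolyRing (n + 1)}

/-- The part of degree |α| + 1 of `demLusWord_raise`: the difference of the sides is homogeneous of
that degree, yet equals an expression of lower degree. -/
theorem demLusWord_X_last_mul_shift (h : IsTriangular α G E) :
    demLusWord (n := n + 1) t (List.finRange n) (X (Fin.last n) * shift n E) =
      C (point α 0)⁻¹ * (X 0 * E) := by
  rw [← sub_eq_zero]
  have hG := h.isInterpolation.mem_low
  have e := demLusWord_raise h.isInterpolation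
  have e2 : raiseOp n G = X (Fin.last n) * shift n E + X (Fin.last n) * shift n (G - E) -
      (t ^ (-(n : ℤ))) • shift n G := by
    rw [raiseOp, map_sub, smul_eq_C_mul]
    ring
  rw [e2, map_sub, map_add, map_smul, smul_eq_C_mul] at e
  have key : demLusWord (n := n + 1) t (List.finRange n) (X (Fin.last n) * shift n E) -
      C (point α 0)⁻¹ * (X 0 * E) =
      C (point α 0)⁻¹ * (X 0 * (G - E)) +
        C (t ^ (-(n : ℤ))) * demLusWord (n := n + 1) t (List.finRange n) (shift n G) -
      demLusWord (n := n + 1) t (List.finRange n) (X (Fin.last n) * shift n (G - E)) - G := by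
    linear_combination e
  refine eq_zero_of_mem_low_of_mem_hom (d := size α + 1) ?_ ?_
  · rw [key]
    refine Submodule.sub_mem _ (Submodule.sub_mem _ (Submodule.add_mem _
      (C_mul_mem_supp _ (mul_mem_low (totalDegree_X _).le h.sub_mem)) (C_mul_mem_supp _ ?_)) ?_) hG
    · exact demLusWord_mem_supp_size (n := n + 1) t _ (· < size α + 1) (shift_mem_low hG)
    · exact demLusWord_mem_supp_size (n := n + 1) t _ (· < size α + 1)
        (mul_mem_low (totalDegree_X _).le (shift_mem_low h.sub_mem))
  · exact Submodule.sub_mem _ (demLusWord_mem_supp_size (n := n + 1) t _ (· = size α + 1)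
      (X_last_mul_shift_mem_hom h.mem_hom)) (C_mul_mem_supp _ (X_mul_mem_hom 0 h.mem_hom))

/-- The telescoping relation and the preceding identity both produce a multiple of x_1 E from the
same injective word, so their arguments are proportional; cancelling the last variable and undoing
the shift makes E an eigenvector. -/
theorem unshift_demLusWord_reverse (h : IsTriangular α G E) :
    unshift n (demLusWord (n := n + 1) t (List.finRange n).reverse E) =
      C (t ^ n * point α 0) * E := by
  have h1 := h.demLusWord_X_last_mul_shift
  have h2 := demLusWord_telescope t E
  have h3 : X (Fin.last n) * demLusWord (n := n + 1) t (List.finRange n).reverse E =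
      (t ^ n * point α 0) • (X (Fin.last n) * shift n E) := by
    apply demLusWord_injective (n := n + 1) t_ne_zero (List.finRange n)
    rw [map_smul, h1, h2, smul_eq_C_mul, ← mul_assoc (C (t ^ n * point α 0)), ← C_mul, mul_assoc,
      mul_inv_cancel₀ (point_ne_zero α 0), mul_one]
  rw [smul_eq_C_mul, mul_left_comm] at h3
  rw [mul_left_cancel₀ (X_ne_zero _) h3, map_mul, unshift_C, unshift_shift]

end IsTriangular

theorem IsTriangular.raise {a : ℕ} {β : Fin n → ℕ} {G E : PolyRing (n + 1)}
    (h : IsTriangular (Fin.cons a β : Fin (n + 1) → ℕ) G E) :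
    ∃ G' E', IsTriangular (Fin.snoc β (a + 1) : Fin (n + 1) → ℕ) G' E' := by
  have hs : size (Fin.snoc β (a + 1) : Fin (n + 1) → ℕ) =
      size (Fin.cons a β : Fin (n + 1) → ℕ) + 1 := by
    rw [size_snoc, size_cons]
    omega
  have hG := h.isInterpolation.mem_low
  have hlow : C (q ^ a) * raiseOp n G - C (q ^ a) * (X (Fin.last n) * shift n E) ∈
      low (n + 1) (size (Fin.snoc β (a + 1) : Fin (n + 1) → ℕ)) := by
    have e : C (q ^ a) * raiseOp n G -
        C (q ^ a) * (X (Fin.last n) * shift n E) =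
        C (q ^ a) * (X (Fin.last n) * shift n (G - E) - C (t ^ (-(n : ℤ))) * shift n G) := by
      rw [raiseOp, map_sub]
      ring
    rw [e, hs]
    exact C_mul_mem_supp _ (Submodule.sub_mem _
      (mul_mem_low (totalDegree_X _).le (shift_mem_low h.sub_mem))
      (C_mul_mem_supp _ (shift_mem_low hG)))
  refine ⟨C (q ^ a) * raiseOp n G, C (q ^ a) * (X (Fin.last n) * shift n E),
    ⟨?_, ?_, ?_⟩, ?_, hlow, ?_⟩
  · rw [← mem_low_succ, hs]
    exact C_mul_mem_supp _ (raise_mem_low hG)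
  · intro γ hγ hne
    change eval (point γ) _ = 0
    rw [eval_mul, eval_raise_eq_zero h.isInterpolation (hs ▸ hγ), mul_zero]
    rwa [Fin.tail_cons, Fin.cons_zero]
  · have h1 := coeff_eq_zero_of_mem_supp hlow (α := Fin.snoc β (a + 1)) (lt_irrefl _)
    rw [coeff_sub, sub_eq_zero] at h1
    rw [h1, coeff_C_mul, coeff_X_last_mul_shift, h.coeff_eq_one, mul_one, ← mul_pow,
      mul_inv_cancel₀ q_ne_zero, one_pow]
  · exact C_mul_mem_supp _ (X_last_mul_shift_mem_below h.below)
  · intro l hl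
    obtain ⟨l0, hl0⟩ := exists_isReducedWord (longest n)
    have hr := demLusWord_eq_of_isReducedWord (n := n + 1) t hl
      (isReducedWord_longest_succ_right hl0)
    have hL := demLusWord_eq_of_isReducedWord (n := n + 1) t hl
      (isReducedWord_longest_succ_left hl0)
    have hE := h.inversion l hl
    rw [hr] at hE
    -- With w₀ factored on the right, `unshift` moves the parabolic word to `hi` letters and the
    -- remaining cycle acts on E by its eigenvalue. This evaluates the `hi` word on E, which the
    -- other factorisation produces in `e1`.
    have hE := congrArg (unshift n) (hE.symm.trans (demLusWord_append (n := n + 1) t _ _ E))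
    rw [unshift_demLusWord] at hE
    have hE := hE.trans (congrArg (demLusWord (n := n + 1) t (l0.map hi))
      h.unshift_demLusWord_reverse)
    rw [← smul_eq_C_mul _ (t ^ n * _), map_smul, map_mul, unshift_C, smul_eq_C_mul] at hE
    have e1 : demLusWord t l (C (q ^ a) * (X (Fin.last n) * shift n E)) =
        C (q ^ a * (point (Fin.cons a β : Fin (n + 1) → ℕ) 0)⁻¹) *
          (X 0 * demLusWord (n := n + 1) t (l0.map hi) E) := by
      rw [hL, ← smul_eq_C_mul, map_smul]
      refine (congrArg (q ^ a • ·) ((demLusWord_append (n := n + 1) t _ _ _).trans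
        (congrArg (demLusWord (n := n + 1) t (l0.map hi)) h.demLusWord_X_last_mul_shift))).trans ?_
      rw [← smul_eq_C_mul, map_smul, demLusWord_map_hi_X_zero_mul]
      rw [smul_smul, smul_eq_C_mul]
    have e2 : rename (longest (n + 1)) (circ (C (q ^ a) * (X (Fin.last n) * shift n E))) =
        C (q⁻¹ ^ a) * (X 0 * unshift n (rename (longest (n + 1)) (circ E))) := by
      rw [← rename_longest_circ_shift]
      simp only [circ, map_mul, map_C, map_pow, iota_q, map_X, rename_C, rename_X, longest_apply,
        Fin.rev_last]
    rw [e1, e2]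
    -- With k the number of entries of β exceeding a, the new last entry contributes k to I, while
    -- the old first entry contributed n - k.
    have hI : invCount (Fin.snoc β (a + 1) : Fin (n + 1) → ℕ) + n =
        invCount (Fin.cons a β : Fin (n + 1) → ℕ) +
          2 * kComp (Fin.cons a β : Fin (n + 1) → ℕ) 0 := by
      have hc := Finset.card_filter_add_card_filter_not (s := (Finset.univ : Finset (Fin n)))
        (fun k => β k ≤ a)
      simp only [not_le, Finset.card_univ, Fintype.card_fin] at hc
      rw [invCount_snoc, invCount_cons, kComp_cons_zero]
      simp only [Nat.succ_le_iff]
      omega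
    set I := invCount (Fin.cons a β : Fin (n + 1) → ℕ)
    set I' := invCount (Fin.snoc β (a + 1) : Fin (n + 1) → ℕ)
    have hk : point (Fin.cons a β : Fin (n + 1) → ℕ) 0 =
        q ^ a * (t ^ kComp (Fin.cons a β : Fin (n + 1) → ℕ) 0)⁻¹ := by
      rw [point_apply, zpow_neg, zpow_natCast, zpow_natCast, Fin.cons_zero]
    set k := kComp (Fin.cons a β : Fin (n + 1) → ℕ) 0
    have hscal : t ^ I * (q ^ a * (point (Fin.cons a β : Fin (n + 1) → ℕ) 0)⁻¹) =
        t ^ I' * q⁻¹ ^ a * (t ^ n * point (Fin.cons a β : Fin (n + 1) → ℕ) 0) := by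
      have hq := q_ne_zero
      have ht := t_ne_zero
      have hp : t ^ I' * t ^ n = t ^ I * (t ^ k) ^ 2 := by
        rw [← pow_add, hI, pow_add, ← pow_mul, mul_comm 2]
      rw [hk, inv_pow]
      field_simp
      linear_combination -hp
    have hscal' := congrArg (C : BaseField → PolyRing (n + 1)) hscal
    have ht : (C (t ^ I) : PolyRing (n + 1)) ≠ 0 := by
      rw [Ne, C_eq_zero]
      exact pow_ne_zero _ t_ne_zero
    apply mul_left_cancel₀ ht
    rw [C_mul, C_mul (a := t ^ I' * q⁻¹ ^ a), C_mul (a := t ^ I')] at hscal'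
    linear_combination X 0 * demLusWord (n := n + 1) t (l0.map hi) E * hscal' -
      C (t ^ I') * C (q⁻¹ ^ a) * X 0 * hE

/-- Every composition has an interpolation polynomial with triangular top part. -/
theorem exists_isTriangular (α : Fin n → ℕ) : ∃ G E, IsTriangular α G E := by
  rcases n with _ | n
  · exact ⟨1, 1, IsTriangular.of_size_eq_zero (by simp [size])⟩
  induction hd : size α using Nat.strong_induction_on generalizing α with
  | _ d ihd =>
    induction hk : invCount α using Nat.strong_induction_on generalizing α with
    | _ k ihk =>
      by_cases h0 : size α = 0
      · exact ⟨1, 1, IsTriangular.of_size_eq_zero h0⟩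
      rcases hb : α (Fin.last n) with _ | a
      -- A nonzero composition ending in 0 cannot be weakly increasing; exchanging a descent lowers
      -- `invCount` at the same size.
      · obtain ⟨i, hi⟩ : ∃ i : Fin (n + 1 - 1), α (InterpolationMacdonald.hi i) < α (lo i) := by
          by_contra! hc
          have hm := monotone_of_lo_le_hi hc
          exact h0 (Finset.sum_eq_zero fun u _ =>
            Nat.le_zero.1 ((hm (Fin.le_last u)).trans_eq hb))
        have h1 := invCount_comp_simple' hi
        obtain ⟨G, E, h⟩ := ihk _ (by omega) (α ∘ simple i) (by rw [size_comp, hd]) rfl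
        have h2 := h.comp_simple (i := i) (by simpa using hi)
        rwa [comp_simple_comp_simple] at h2
      · have e : α = Fin.snoc (fun k => α k.castSucc) (a + 1) := by
          rw [← hb]
          exact (Fin.snoc_init_self α).symm
        generalize (fun k : Fin n => α k.castSucc) = β at e
        rw [e, size_snoc] at hd
        obtain ⟨G, E, h⟩ := ihd (size (Fin.cons a β : Fin (n + 1) → ℕ))
          (by rw [size_cons]; omega) _ rfl
        rw [e]
        exact h.raise

end Main

section Primed

variable {n : ℕ} {α : Fin n → ℕ}

/-! ### The primed interpolation polynomials -/

theorem rename_longest_rename_longest (f : PolyRing n) :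
    rename (longest n) (rename (longest n) f) = f := by
  rw [rename_rename, show ⇑(longest n) ∘ ⇑(longest n) = id from funext fun k => Fin.rev_rev k,
    rename_id_apply]

theorem eval_tilde (β : Fin n → ℕ) (f : PolyRing n) :
    eval (tilde fun i => (β i : ℤ)) f =
      iota (eval (point β) (rename (longest n) (dual f))) := by
  rw [eval_rename, tilde_eq]
  have h := eval_dual (point β ∘ longest n) (dual f)
  rwa [dual_dual] at h

theorem IsPrimedInterpolation.unique {G P Q : PolyRing n} (hP : IsPrimedInterpolation α G P)
    (hQ : IsPrimedInterpolation α G Q) : P = Q := by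
  have hlow : P - Q ∈ low n (size α) := by
    refine mem_low_of_homogeneousComponent_eq_zero (Submodule.sub_mem _
      (mem_low_succ.2 hP.degree_le) (mem_low_succ.2 hQ.degree_le)) ?_
    rw [map_sub, hP.top_eq, hQ.top_eq, sub_self]
  have h0 : rename (longest n) (dual (P - Q)) = 0 := by
    refine eq_zero_of_vanishing
      (rename_mem_supp_size _ (· < size α) (dual_mem_supp hlow)) fun β hβ => ?_
    rw [← map_eq_zero iota, ← eval_tilde, eval_sub, hP.vanishing β hβ, hQ.vanishing β hβ, sub_self]
  have h1 : dual (P - Q) = 0 := by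
    rw [← rename_longest_rename_longest (dual (P - Q)), h0, map_zero]
  rw [← sub_eq_zero, ← dual_dual (P - Q), h1]
  simp [dual, circ, scale]

/-- The right hand side of the formula for `G'_α(t^(n-1) x; q⁻¹, t⁻¹)`. -/
def primedDual (α : Fin n → ℕ) (l : List (Fin (n - 1))) (G : PolyRing n) : PolyRing n :=
  C (t ^ (((n : ℤ) - 1) * (size α : ℤ) - (invCount α : ℤ))) *
    rename (longest n) (demLusWord t l G)

theorem primedDual_sub (l : List (Fin (n - 1))) (G E : PolyRing n) :
    primedDual α l (G - E) = primedDual α l G - primedDual α l E := by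
  simp only [primedDual, map_sub, mul_sub]

theorem primedDual_mem_supp_size (l : List (Fin (n - 1))) (P : ℕ → Prop) {G : PolyRing n}
    (hG : G ∈ supp fun γ => P (size γ)) : primedDual α l G ∈ supp fun γ => P (size γ) :=
  C_mul_mem_supp _ (rename_mem_supp_size _ P (demLusWord_mem_supp_size t l P hG))

/-- The inversion identity cancels both w₀ and t^I(α); the remaining power of t is what the scaling
in `dual` produces in degree |α|. -/
theorem IsTriangular.primedDual_top {G E : PolyRing n} (h : IsTriangular α G E)
    {l : List (Fin (n - 1))} (hl : IsReducedWord l (longest n)) :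
    primedDual α l E = dual E := by
  rw [primedDual, h.inversion l hl, map_mul, rename_C, rename_longest_rename_longest, ← mul_assoc,
    ← C_mul, dual, scale_of_mem_hom _ (circ_mem_supp h.mem_hom), ← zpow_natCast t,
    ← zpow_add₀ t_ne_zero, sub_add_cancel, ← zpow_natCast, ← zpow_mul]

theorem IsTriangular.isPrimedInterpolation {G E : PolyRing n} (h : IsTriangular α G E)
    {l : List (Fin (n - 1))} (hl : IsReducedWord l (longest n)) :
    IsPrimedInterpolation α G (dual (primedDual α l G)) := by
  refine ⟨?_, ?_, fun β hβ => ?_⟩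
  · rw [← mem_low_succ]
    exact dual_mem_supp (primedDual_mem_supp_size l (· < size α + 1) h.isInterpolation.mem_low)
  · have h1 : dual (primedDual α l (G - E)) ∈ low n (size α) :=
      dual_mem_supp (primedDual_mem_supp_size l (· < size α) h.sub_mem)
    rw [primedDual_sub, h.primedDual_top hl, dual_sub, dual_dual] at h1
    have e1 := homogeneousComponent_eq_zero_of_mem_low h1
    have e2 := homogeneousComponent_eq_zero_of_mem_low h.sub_mem
    rw [map_sub, sub_eq_zero] at e1 e2
    rw [e1, e2]
  · rw [eval_tilde, dual_dual, primedDual, map_mul, rename_longest_rename_longest, rename_C,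
      eval_mul, eval_demLusWord_eq_zero (fun β hβ => h.isInterpolation.vanishing β hβ.le
        fun he => hβ.ne (congrArg size he)) l β hβ, mul_zero, map_zero]

theorem dual_primedDual (l : List (Fin (n - 1))) (G : PolyRing n) :
    dual (primedDual α l G) =
      C (t ^ ((1 - (n : ℤ)) * (size α : ℤ) + (invCount α : ℤ))) *
        rename (longest n) (demLusWord t⁻¹ l (dual G)) := by
  rw [primedDual, dual_C_mul, dual_rename, dual_demLusWord, map_zpow₀, iota_t, inv_zpow']
  congr 4
  ring

theorem algebraMap_C_mul (c : BaseField) (f : PolyRing n) :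
    algebraMap (PolyRing n) (RatFun n) (C c * f) = c • algebraMap (PolyRing n) (RatFun n) f := by
  rw [← smul_eq_C_mul]
  exact map_smul (IsScalarTower.toAlgHom BaseField (PolyRing n) (RatFun n)) c f

end Primed

end InterpolationMacdonald

end

theorem theoremA (n : ℕ) (α : Fin n → ℕ) :
    (∃! G : PolyRing n, IsInterpolation α G) ∧
    ∀ G : PolyRing n, IsInterpolation α G →
      (∃! G' : PolyRing n, IsPrimedInterpolation α G G') ∧
      ∀ G' : PolyRing n, IsPrimedInterpolation α G G' →
        ∀ l : List (Fin (n - 1)), IsReducedWord l (longest n) →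
          algebraMap (PolyRing n) (RatFun n) G' =
            t ^ ((1 - (n : ℤ)) * (size α : ℤ) + (invCount α : ℤ)) •
              permute (longest n) (heckeWord t⁻¹ l
                (algebraMap (PolyRing n) (RatFun n) (scale (t ^ ((n : ℤ) - 1)) (circ G)))) ∧
          algebraMap (PolyRing n) (RatFun n) (scale (t ^ ((n : ℤ) - 1)) (circ G')) =
            t ^ (((n : ℤ) - 1) * (size α : ℤ) - (invCount α : ℤ)) •
              permute (longest n) (heckeWord t l (algebraMap (PolyRing n) (RatFun n) G)) := by
  obtain ⟨G₀, E, h⟩ := exists_isTriangular α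
  refine ⟨⟨G₀, h.isInterpolation, fun F hF => h.isInterpolation.unique hF⟩, fun G hG => ?_⟩
  obtain rfl := h.isInterpolation.unique hG
  obtain ⟨l₀, hl₀⟩ := exists_isReducedWord (longest n)
  refine ⟨⟨_, h.isPrimedInterpolation hl₀, fun P hP => hP.unique (h.isPrimedInterpolation hl₀)⟩,
    fun G' hG' l hl => ?_⟩
  -- Both formulas are this one identity, read directly and after applying the involution `dual`.
  have e := hG'.unique (h.isPrimedInterpolation hl)
  constructor
  · rw [heckeWord_algebraMap, permute_algebraMap, ← algebraMap_C_mul, e, dual_primedDual, dual]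
  · change algebraMap (PolyRing n) (RatFun n) (dual G') = _
    rw [heckeWord_algebraMap, permute_algebraMap, ← algebraMap_C_mul, e, dual_dual, primedDual]
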